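/- For integers $1\le s\le p$ and $\gamma\in[0,1]$, let $P_{\theta,\gamma}=N\big(\theta,(1-\gamma)I_p+\gamma\mathbf 1_p\mathbf 1_p^{\top}\big)$ be the law on $\mathbb R^p$ of the observation with mean $\theta\in\mathbb R^p$. For $\varepsilon>0$ put $$\Theta(p,s,\varepsilon)=\{\theta\in\mathbb R^p:\ \|\theta\|\ge\varepsilon,\ \|\theta\|_0\le s\},$$ where $\|\cdot\|$ is the Euclidean norm and $\|\theta\|_0$ is the number of nonzero coordinates of $\theta$. Consider testing $H_0:\theta=0$ against $H_1:\theta\in\Theta(p,s,\varepsilon)$, with minimax risk $$\mathcal R_{p,s,\gamma}(\varepsilon)=\inf_{\varphi}\Big\{P_{0,\gamma}\{\varphi=1\}+\sup_{\theta\in\Theta(p,s,\varepsilon)}P_{\theta,\gamma}\{\varphi=0\}\Big\},$$ the infimum being over all measurable tests $\varphi:\mathbb R^p\to\{0,1\}$. A function $\varepsilon^*=\varepsilon^*(p,s,\gamma)\ge 0$ is called a minimax separation rate if for every $\eta\in(0,1)$ there are constants $C_\eta,c_\eta>0$ depending only on $\eta$ such that, for all $1\le s\le p$ and $\gamma\in[0,1]$,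 (i) $\mathcal R_{p,s,\gamma}(\varepsilon)\le\eta$ for every $\varepsilon>0$ with $\varepsilon>C_\eta\,\varepsilon^*(p,s,\gamma)$; (ii) $\mathcal R_{p,s,\gamma}(\varepsilon)\ge 1-\eta$ for every $0<\varepsilon<c_\eta\,\varepsilon^*(p,s,\gamma)$. (In particular, $\varepsilon^*(p,s,\gamma)=0$ means that $\mathcal R_{p,s,\gamma}(\varepsilon)=0$ for every $\varepsilon>0$.) **Theorem.** For $1\le s\le p$ and $\gamma\in[0,1]$ let (the first case that applies being used) $$\psi^2(p,s,\gamma)=\begin{cases} (1-\gamma)\,s\log\!\big(1+\tfrac{p}{s^2}\big) & \text{if } s<\sqrt p,\\[2pt] (1-\gamma)\sqrt p+\Big[\tfrac{(1-\gamma)p^{3/2}}{p-s}\wedge(1-\gamma+\gamma p)\Big] & \text{if } \sqrt p\le s\le p-\sqrt p,\\[2pt] (1-\gamma)\sqrt p+\Big[(1-\gamma)\,p\log\!\big(1+\tfrac{p}{(p-s)^2}\big)\wedge(1-\gamma+\gamma p)\Big] & \text{if } p-\sqrt p<s\le p, \end{cases}$$ where for $s=p$ the bracket in the last line is read as $1-\gamma+\gamma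 p$ (for $\gamma=1$ as well). Then $\psi=\sqrt{\psi^2}$ is a minimax separation rate, and every minimax separation rate $\varepsilon^*$ satisfies $\varepsilon^*(p,s,\gamma)^2\asymp\psi^2(p,s,\gamma)$; that is, there are constants $a,b>0$, not depending on $p,s,\gamma$, such that $a\,\psi^2(p,s,\gamma)\le\varepsilon^*(p,s,\gamma)^2\le b\,\psi^2(p,s,\gamma)$ for all $1\le s\le p$ and $\gamma\in[0,1]$. -/

import Mathlib

namespace SparseDetection

open MeasureTheory ProbabilityTheory
open scoped ENNReal

/-- The equicorrelation matrix `(1 - γ) I + γ 1 1ᵀ` of size `p × p`. -/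
noncomputable def equicorrelation (p : ℕ) (γ : ℝ) : Matrix (Fin p) (Fin p) ℝ :=
  (1 - γ) • (1 : Matrix (Fin p) (Fin p) ℝ) + γ • Matrix.vecMulVec 1 1

/-- For `γ ∈ [0, 1]` the equicorrelation matrix is a covariance matrix, so that
`multivariateGaussian` has no default value in the definition of `law` below. -/
theorem equicorrelation_posSemidef (p : ℕ) {γ : ℝ} (hγ : γ ∈ Set.Icc (0 : ℝ) 1) :
    (equicorrelation p γ).PosSemidef := by
  refine Matrix.PosSemidef.add ?_ ?_
  · exact Matrix.PosSemidef.one.smul (by linarith [hγ.2])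
  · have h := Matrix.posSemidef_vecMulVec_self_star (1 : Fin p → ℝ)
    rw [star_one] at h
    exact h.smul hγ.1

/-- The law `P_{θ, γ} = N(θ, (1 - γ) I + γ 1 1ᵀ)` of the observation (degenerate for `γ = 1`). -/
noncomputable def law (p : ℕ) (γ : ℝ) (θ : EuclideanSpace ℝ (Fin p)) :
    Measure (EuclideanSpace ℝ (Fin p)) :=
  multivariateGaussian θ (equicorrelation p γ)

/-- The alternative `Θ(p, s, ε)`: vectors of Euclidean norm at least `ε` with at most `s` nonzero
coordinates. -/
def alternative (p s : ℕ) (ε : ℝ) : Set (EuclideanSpace ℝ (Fin p)) :=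
  {θ | ε ≤ ‖θ‖ ∧ {i : Fin p | θ i ≠ 0}.ncard ≤ s}

/-- The minimax testing risk `R(ε)`: the infimum over all measurable tests `φ : ℝᵖ → {0, 1}` of the
type I error plus the worst-case type II error over `Θ(p, s, ε)`. -/
noncomputable def risk (p s : ℕ) (γ ε : ℝ) : ℝ≥0∞ :=
  ⨅ (φ : EuclideanSpace ℝ (Fin p) → Fin 2) (_ : Measurable φ),
    law p γ 0 {x | φ x = 1} + ⨆ θ ∈ alternative p s ε, law p γ θ {x | φ x = 0}

/-- `εs` is a minimax separation rate. The constants `C` and `c` depend on `η` only, not on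
`(p, s, γ)`. The problem is posed for separations `ε > 0` only. Where `εs p s γ > 0`, the condition
`C * εs p s γ < ε` says that `ε = C' * εs p s γ` with `C' > C`, and `0 < ε < c * εs p s γ` says that
`ε = c' * εs p s γ` with `0 < c' < c`. Where `εs p s γ = 0` (a degenerate rate), the first clause
says that the risk is at most `η` at every separation `ε > 0`, and the second is void. -/
def IsMinimaxSeparationRate (εs : ℕ → ℕ → ℝ → ℝ) : Prop :=
  (∀ (p s : ℕ) (γ : ℝ), 1 ≤ s → s ≤ p → γ ∈ Set.Icc (0 : ℝ) 1 → 0 ≤ εs p s γ) ∧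
  (∀ η ∈ Set.Ioo (0 : ℝ) 1, ∃ C : ℝ, 0 < C ∧
    ∀ (p s : ℕ) (γ : ℝ), 1 ≤ s → s ≤ p → γ ∈ Set.Icc (0 : ℝ) 1 →
      ∀ ε : ℝ, 0 < ε → C * εs p s γ < ε → risk p s γ ε ≤ ENNReal.ofReal η) ∧
  (∀ η ∈ Set.Ioo (0 : ℝ) 1, ∃ c : ℝ, 0 < c ∧
    ∀ (p s : ℕ) (γ : ℝ), 1 ≤ s → s ≤ p → γ ∈ Set.Icc (0 : ℝ) 1 →
      ∀ ε : ℝ, 0 < ε → ε < c * εs p s γ → ENNReal.ofReal (1 - η) ≤ risk p s γ ε)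

/-- The squared rate. The last branch is `s = p`: there `p / (p - s) ^ 2` and its logarithm are read
as `+∞`, so that the minimum is `1 - γ + γ p` (for `γ = 1` too). -/
noncomputable def rateSq (p s : ℕ) (γ : ℝ) : ℝ :=
  if (s : ℝ) < Real.sqrt p then
    (1 - γ) * s * Real.log (1 + (p : ℝ) / (s : ℝ) ^ 2)
  else if (s : ℝ) ≤ p - Real.sqrt p then
    (1 - γ) * Real.sqrt p
      + min ((1 - γ) * (p : ℝ) ^ (3 / 2 : ℝ) / ((p : ℝ) - s)) (1 - γ + γ * p)
  else if s < p then
    (1 - γ) * Real.sqrt p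
      + min ((1 - γ) * p * Real.log (1 + (p : ℝ) / ((p : ℝ) - s) ^ 2)) (1 - γ + γ * p)
  else
    (1 - γ) * Real.sqrt p + (1 - γ + γ * p)

end SparseDetection

/-!
Write `σ² = 1 - γ`. The observation is `θ + √γ W 1 + σ Z` with a common factor `W` and independent
standard normal `Z i`, that is, a linear image of a standard Gaussian vector (`law_eq_map`). The
common factor only perturbs the mean of the coordinates: the deviations from the mean carry the
projected signal `θ - θ̄ 1` in noise of level `σ`, and the sum of the coordinates has variance
`p (1 - γ + γ p)`.

*Upper bound.* Three tests suffice. The sample mean detects `p θ̄² ≳ 1 - γ + γ p`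
(`meanRegion_alt`). The sum of squared deviations detects `‖θ - θ̄ 1‖² ≳ σ² √p`
(`chiRegion_alt`), and an `s`-sparse `θ` keeps at least the fraction `1 - s / p` of its energy under
projection. The third test rejects when `∑ i, cosh (l (x i - x̄) / σ)` is large, with
`l² = log (1 + p / m²)` and `m² ≤ p` (`coshRegion_alt`). It detects `m` coordinates of the projected
signal of size a large multiple of `l σ`, and by convexity any `m` coordinates of the same total
energy. For `s < √p` it is used with `m = s` and the support of `θ`. For `s > p - √p` it is used
with `m = p - s` and the zeros of `θ`, which become equal to `-θ̄` after projection: a dense signal with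
little projected energy has a large mean, so that its zeros stick out. The power is obtained without
a second moment of the large terms: each noise coordinate is bounded with high probability, and
Markov's inequality shows that the large terms keep a constant fraction of their total weight.

*Lower bound.* By the Cameron–Martin formula (`map_add_gaussianVector`) the chi-square divergence of
a finite mixture of translates `h i` of a standard Gaussian vector is the average of
`exp ⟪h i, h j⟫` minus one, and Le Cam's method applies (`le_risk_of_mixture`). The coordinates are
grouped in `m` blocks of length `b ≈ p / m`, and one coordinate is picked uniformly in each block,
so that the overlap of two picks is binomial. The sparse prior puts `τ` on the picked coordinates
(`le_risk_sparse`). The dense prior puts `0` on the picked coordinates and `τ` on the rest of the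
blocks, and fills up with `τ (1 - 1 / b)` outside (`le_risk_dense`): this is a constant vector,
which is absorbed by the common factor or by the idiosyncratic noise, plus a vector that sums to zero on
each block. The centring turns the divergence exponent `m (exp a - 1) / b`, `a = τ² / σ²`, into
`m (exp a - 1 - a) / b`, which is of second order in `a`. This yields the term `p^(3/2) / (p - s)`
of the rate for `p - s ≥ √p` and the logarithmic one for `p - s < √p`.

Two separation rates agree up to constants because the risk cannot be both small and close to one
(`IsMinimaxSeparationRate.le_const_mul`).
-/

namespace SparseDetection

open MeasureTheory ProbabilityTheory
open scoped ENNReal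

/-! ### Standard Gaussian vectors -/

/-- The law of a family of independent standard normal variables indexed by `ι`. -/
noncomputable abbrev gaussianVector (ι : Type*) [Fintype ι] : Measure (ι → ℝ) :=
  Measure.pi fun _ => gaussianReal 0 1

section Gaussian

variable {ι : Type*} [Fintype ι]

theorem integrable_exp_linear (a : ι → ℝ) :
    Integrable (fun z : ι → ℝ => Real.exp (∑ i, a i * z i)) (gaussianVector ι) := by
  simp_rw [Real.exp_sum]
  exact Integrable.fintype_prod (f := fun i x => Real.exp (a i * x))
    fun i => integrable_exp_mul_gaussianReal (a i)

theorem integral_exp_linear (a : ι → ℝ) :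
    ∫ z, Real.exp (∑ i, a i * z i) ∂gaussianVector ι = Real.exp ((∑ i, a i ^ 2) / 2) := by
  simp_rw [Real.exp_sum]
  rw [integral_fintype_prod_eq_prod (f := fun i x => Real.exp (a i * x))]
  have h : ∀ t : ℝ, ∫ x, Real.exp (t * x) ∂gaussianReal 0 1 = Real.exp (t ^ 2 / 2) := by
    intro t
    have := congrFun (mgf_id_gaussianReal (μ := 0) (v := 1)) t
    simpa [mgf] using this
  simp_rw [h, ← Real.exp_sum, Finset.sum_div]

theorem memLp_linear (a : ι → ℝ) :
    MemLp (fun z : ι → ℝ => ∑ i, a i * z i) 2 (gaussianVector ι) := by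
  refine memLp_finsetSum _ fun i _ => ?_
  exact ((memLp_id_gaussianReal' 2 (by simp)).const_mul (a i)).comp_measurePreserving
    (measurePreserving_eval (fun _ : ι => gaussianReal 0 1) i)

theorem integral_linear_sq (a : ι → ℝ) :
    ∫ z, (∑ i, a i * z i) ^ 2 ∂gaussianVector ι = ∑ i, a i ^ 2 := by
  have hmem : ∀ i, MemLp (fun x : ℝ => a i * x) 2 (gaussianReal 0 1) := fun i =>
    (memLp_id_gaussianReal' 2 (by simp)).const_mul (a i)
  have hv := variance_sum_pi (μ := fun _ : ι => gaussianReal 0 1) (X := fun i x => a i * x) hmem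
  have hfun : (∑ i, fun ω : ι → ℝ => a i * ω i) = fun z => ∑ i, a i * z i := by
    ext z; simp
  have h0 : ∫ z, (∑ i, a i * z i) ∂gaussianVector ι = 0 := by
    rw [integral_finsetSum]
    · refine Finset.sum_eq_zero fun i _ => ?_
      rw [integral_const_mul, integral_eval]
      simp
    · intro i _
      exact (integrable_eval (i := i) (μ := fun _ : ι => gaussianReal 0 1)
        ((memLp_id_gaussianReal' 1 (by simp)).integrable le_rfl)).const_mul _
  rw [hfun,
    variance_of_integral_eq_zero (memLp_linear a).aestronglyMeasurable.aemeasurable h0] at hv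
  rw [hv]
  refine Finset.sum_congr rfl fun i _ => ?_
  rw [variance_const_mul, variance_fun_id_gaussianReal]
  simp

/-- Hyperbolic cosines of Gaussian linear forms have closed-form expectations. -/
theorem integral_cosh_linear (a : ι → ℝ) (b : ℝ) :
    ∫ z, Real.cosh (b + ∑ i, a i * z i) ∂gaussianVector ι
      = Real.exp ((∑ i, a i ^ 2) / 2) * Real.cosh b := by
  have h1 := (integrable_exp_linear a).const_mul (Real.exp b / 2)
  have h2 := (integrable_exp_linear (-a)).const_mul (Real.exp (-b) / 2)
  have he : ∀ z : ι → ℝ, Real.cosh (b + ∑ i, a i * z i)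
      = Real.exp b / 2 * Real.exp (∑ i, a i * z i)
        + Real.exp (-b) / 2 * Real.exp (∑ i, (-a) i * z i) := by
    intro z
    rw [Real.cosh_eq, neg_add, Real.exp_add, Real.exp_add]
    simp only [Pi.neg_apply, neg_mul, Finset.sum_neg_distrib]
    ring
  simp_rw [he]
  rw [integral_add h1 h2, integral_const_mul, integral_const_mul, integral_exp_linear,
    integral_exp_linear, Real.cosh_eq]
  simp only [Pi.neg_apply, neg_sq]
  ring

theorem integrable_cosh_linear (a : ι → ℝ) (b : ℝ) :
    Integrable (fun z : ι → ℝ => Real.cosh (b + ∑ i, a i * z i)) (gaussianVector ι) := by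
  have h1 := (integrable_exp_linear a).const_mul (Real.exp b / 2)
  have h2 := (integrable_exp_linear (-a)).const_mul (Real.exp (-b) / 2)
  refine (h1.add h2).congr (Filter.Eventually.of_forall fun z => ?_)
  simp only [Pi.add_apply, Pi.neg_apply, neg_mul, Finset.sum_neg_distrib]
  rw [Real.cosh_eq, neg_add, Real.exp_add, Real.exp_add]
  ring

/-- One-dimensional Cameron–Martin formula. -/
theorem gaussianReal_eq_withDensity (h : ℝ) :
    gaussianReal h 1 = (gaussianReal 0 1).withDensity
      (fun x => ENNReal.ofReal (Real.exp (h * x - h ^ 2 / 2))) := by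
  rw [gaussianReal_of_var_ne_zero _ one_ne_zero, gaussianReal_of_var_ne_zero _ one_ne_zero,
    ← withDensity_mul _ (measurable_gaussianPDF _ _) (by fun_prop)]
  congr 1
  ext x
  simp only [gaussianPDF, Pi.mul_apply]
  rw [← ENNReal.ofReal_mul (gaussianPDFReal_nonneg _ _ _), gaussianPDFReal, gaussianPDFReal,
    mul_assoc _ (Real.exp _) (Real.exp _), ← Real.exp_add]
  congr 3
  simp only [NNReal.coe_one]
  ring

/-- Cameron–Martin formula: translating a standard Gaussian vector by `h` amounts to the change of
density `exp (⟨h, z⟩ - ‖h‖² / 2)`. -/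
theorem map_add_gaussianVector (h : ι → ℝ) :
    (gaussianVector ι).map (fun z => z + h) = (gaussianVector ι).withDensity
      (fun z => ENNReal.ofReal (Real.exp (∑ i, (h i * z i - h i ^ 2 / 2)))) := by
  have h1 : (gaussianVector ι).map (fun z => z + h) = Measure.pi fun i => gaussianReal (h i) 1 := by
    have := Measure.pi_map_pi (μ := fun _ : ι => gaussianReal 0 1) (f := fun i x => x + h i)
      (fun i => by fun_prop)
    simp only [gaussianReal_map_add_const, zero_add] at this
    exact this
  rw [h1]
  refine Measure.pi_eq fun s hs => ?_
  have hint : ∀ i, Integrable ((s i).indicator fun x => Real.exp (h i * x - h i ^ 2 / 2))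
      (gaussianReal 0 1) := by
    intro i
    refine Integrable.indicator ?_ (hs i)
    have := (integrable_exp_mul_gaussianReal (μ := 0) (v := 1) (h i)).mul_const
      (Real.exp (-(h i ^ 2 / 2)))
    simpa only [← Real.exp_add, ← sub_eq_add_neg] using this
  have hnn : ∀ i x, 0 ≤ (s i).indicator (fun x => Real.exp (h i * x - h i ^ 2 / 2)) x :=
    fun i x => Set.indicator_nonneg (fun _ _ => (Real.exp_pos _).le) x
  rw [withDensity_apply _ (MeasurableSet.univ_pi hs),
    ← lintegral_indicator (MeasurableSet.univ_pi hs)]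
  have hind : ∀ z : ι → ℝ, (Set.univ.pi s).indicator
      (fun z => ENNReal.ofReal (Real.exp (∑ i, (h i * z i - h i ^ 2 / 2)))) z
      = ENNReal.ofReal
        (∏ i, (s i).indicator (fun x => Real.exp (h i * x - h i ^ 2 / 2)) (z i)) := by
    intro z
    by_cases hz : z ∈ Set.univ.pi s
    · rw [Set.indicator_of_mem hz, Real.exp_sum]
      congr 1
      exact Finset.prod_congr rfl fun i _ => by rw [Set.indicator_of_mem (hz i trivial)]
    · rw [Set.indicator_of_notMem hz]
      simp only [Set.mem_pi, Set.mem_univ, true_imp_iff, not_forall] at hz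
      obtain ⟨i, hi⟩ := hz
      rw [Finset.prod_eq_zero (Finset.mem_univ i) (Set.indicator_of_notMem hi _)]
      simp
  simp_rw [hind]
  rw [← ofReal_integral_eq_lintegral_ofReal
    (Integrable.fintype_prod (f := fun i x =>
      (s i).indicator (fun x => Real.exp (h i * x - h i ^ 2 / 2)) x) hint)
    (Filter.Eventually.of_forall fun z => Finset.prod_nonneg fun i _ => hnn i _),
    integral_fintype_prod_eq_prod (f := fun i x =>
      (s i).indicator (fun x => Real.exp (h i * x - h i ^ 2 / 2)) x),
    ENNReal.ofReal_prod_of_nonneg fun i _ => integral_nonneg (hnn i)]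
  refine Finset.prod_congr rfl fun i _ => ?_
  rw [gaussianReal_eq_withDensity (h i), withDensity_apply _ (hs i),
    ofReal_integral_eq_lintegral_ofReal (hint i) (Filter.Eventually.of_forall (hnn i)),
    ← lintegral_indicator (hs i)]
  congr 1
  ext x
  by_cases hx : x ∈ s i <;> simp [hx]

/-- Chebyshev's inequality for a variable with a known second moment. -/
theorem measureReal_le_of_sq {Ω : Type*} [MeasurableSpace Ω] {P : Measure Ω} [IsFiniteMeasure P]
    {f : Ω → ℝ} (hf : Integrable (fun ω => f ω ^ 2) P) {t δ : ℝ} (ht : 0 < t)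
    (h : ∫ ω, f ω ^ 2 ∂P ≤ δ * t ^ 2) : P.real {ω | t ≤ |f ω|} ≤ δ := by
  have h1 := mul_meas_ge_le_integral_of_nonneg
    (Filter.Eventually.of_forall fun ω => sq_nonneg (f ω)) hf (t ^ 2)
  have hset : {ω | t ^ 2 ≤ f ω ^ 2} = {ω | t ≤ |f ω|} := by
    ext ω
    simp only [Set.mem_ofPred_eq]
    rw [← sq_abs (f ω)]
    exact pow_le_pow_iff_left₀ ht.le (abs_nonneg _) two_ne_zero
  rw [hset] at h1
  have : t ^ 2 * P.real {ω | t ≤ |f ω|} ≤ t ^ 2 * δ := h1.trans (by linarith)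
  exact le_of_mul_le_mul_left this (by positivity)

theorem measureReal_le_of_integral {Ω : Type*} [MeasurableSpace Ω] {P : Measure Ω}
    {f : Ω → ℝ} (hf : Integrable f P) (hnn : ∀ ω, 0 ≤ f ω) {t δ : ℝ} (ht : 0 < t)
    (h : ∫ ω, f ω ∂P ≤ δ * t) : P.real {ω | t ≤ f ω} ≤ δ := by
  have h1 := mul_meas_ge_le_integral_of_nonneg (Filter.Eventually.of_forall hnn) hf t
  have : t * P.real {ω | t ≤ f ω} ≤ t * δ := h1.trans (by linarith)
  exact le_of_mul_le_mul_left this ht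

theorem measureReal_linear_le (a : ι → ℝ) {t δ : ℝ} (ht : 0 < t) (h : ∑ i, a i ^ 2 ≤ δ * t ^ 2) :
    (gaussianVector ι).real {z | t ≤ |∑ i, a i * z i|} ≤ δ :=
  measureReal_le_of_sq (memLp_linear a).integrable_sq ht (by rwa [integral_linear_sq])

end Gaussian

/-! ### The observation as a linear image of Gaussian noise -/

section Observation

/-- The observation `θ + √γ W 1 + √(1 - γ) Z`, where the common factor `W` is the coordinate
`none` of the noise vector and the idiosyncratic noise `Z` consists of the coordinates `some i`. -/
noncomputable def obs (p : ℕ) (γ : ℝ) (θ : EuclideanSpace ℝ (Fin p)) (z : Option (Fin p) → ℝ) :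
    EuclideanSpace ℝ (Fin p) :=
  WithLp.toLp 2 fun i => θ i + √γ * z none + √(1 - γ) * z (some i)

variable {p : ℕ} {γ : ℝ}

@[simp]
theorem obs_apply (θ : EuclideanSpace ℝ (Fin p)) (z : Option (Fin p) → ℝ) (i : Fin p) :
    obs p γ θ z i = θ i + √γ * z none + √(1 - γ) * z (some i) := rfl

@[fun_prop]
theorem measurable_obs (θ : EuclideanSpace ℝ (Fin p)) : Measurable (obs p γ θ) := by
  unfold obs
  fun_prop

theorem law_eq_map (hγ : γ ∈ Set.Icc (0 : ℝ) 1) (θ : EuclideanSpace ℝ (Fin p)) :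
    law p γ θ = (gaussianVector (Option (Fin p))).map (obs p γ θ) := by
  have : IsProbabilityMeasure (law p γ θ) := by unfold law; infer_instance
  have : IsProbabilityMeasure ((gaussianVector (Option (Fin p))).map (obs p γ θ)) :=
    Measure.isProbabilityMeasure_map (by fun_prop)
  refine Measure.ext_of_charFun ?_
  ext t
  rw [law, charFun_multivariateGaussian (equicorrelation_posSemidef p hγ), charFun_apply,
    integral_map (by fun_prop) (Measurable.aestronglyMeasurable (by fun_prop))]
  set a : Option (Fin p) → ℝ := fun o => o.elim (√γ * ∑ i, t i) (fun i => √(1 - γ) * t i) with ha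
  have hexp : ∀ z, Complex.exp ((inner ℝ (obs p γ θ z) t : ℝ) * Complex.I)
      = Complex.exp ((inner ℝ t θ : ℝ) * Complex.I)
        * ∏ o, Complex.exp (a o * z o * Complex.I) := by
    intro z
    rw [← Complex.exp_sum, ← Complex.exp_add]
    congr 1
    rw [← Finset.sum_mul, ← add_mul]
    congr 1
    norm_cast
    simp only [PiLp.inner_apply, obs_apply, Fintype.sum_option, ha, Option.elim, RCLike.inner_apply,
      conj_trivial]
    rw [Finset.mul_sum, Finset.sum_mul, ← Finset.sum_add_distrib, ← Finset.sum_add_distrib]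
    exact Finset.sum_congr rfl fun i _ => by ring
  simp_rw [hexp]
  rw [integral_const_mul, integral_fintype_prod_eq_prod
    (f := fun o (x : ℝ) => Complex.exp (a o * x * Complex.I))]
  have hc : ∀ r : ℝ, ∫ x : ℝ, Complex.exp (r * x * Complex.I) ∂gaussianReal 0 1
      = Complex.exp (-(r ^ 2 / 2 : ℝ)) := by
    intro r
    rw [← charFun_apply_real, charFun_gaussianReal]
    simp
  simp_rw [hc]
  rw [← Complex.exp_sum, ← Complex.exp_add]
  congr 1
  rw [sub_eq_add_neg]
  congr 1
  norm_cast
  have h1 : √γ ^ 2 = γ := Real.sq_sqrt hγ.1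
  have h2 : √(1 - γ) ^ 2 = 1 - γ := Real.sq_sqrt (by linarith [hγ.2])
  simp only [Fintype.sum_option, ha, Option.elim, mul_pow, h1, h2]
  have hq : WithLp.ofLp t ⬝ᵥ Matrix.mulVec (equicorrelation p γ) (WithLp.ofLp t)
      = (1 - γ) * ∑ i, t i ^ 2 + γ * (∑ i, t i) ^ 2 := by
    simp only [equicorrelation, Matrix.add_mulVec, Matrix.smul_mulVec, Matrix.one_mulVec,
      dotProduct_add, dotProduct_smul, smul_eq_mul, Matrix.vecMulVec_mulVec]
    simp only [dotProduct, Pi.one_apply, one_mul, MulOpposite.smul_eq_mul_unop,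
      MulOpposite.unop_op, ← Finset.sum_mul]
    congr 1
    · congr 1
      exact Finset.sum_congr rfl fun i _ => by ring
    · ring
  rw [hq, Finset.sum_neg_distrib, ← Finset.sum_div, ← Finset.mul_sum]
  ring

theorem law_apply (hγ : γ ∈ Set.Icc (0 : ℝ) 1) (θ : EuclideanSpace ℝ (Fin p))
    {A : Set (EuclideanSpace ℝ (Fin p))} (hA : MeasurableSet A) :
    law p γ θ A
      = ENNReal.ofReal ((gaussianVector (Option (Fin p))).real (obs p γ θ ⁻¹' A)) := by
  rw [law_eq_map hγ, Measure.map_apply (by fun_prop) hA, ofReal_measureReal]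

end Observation

/-! ### Lower bounds on the risk by mixtures -/

section Mixture

variable {ι : Type*} [Fintype ι]

/-- The density of the standard Gaussian vector translated by `h`. -/
noncomputable def shiftDensity (h z : ι → ℝ) : ℝ :=
  Real.exp (∑ i, (h i * z i - h i ^ 2 / 2))

theorem shiftDensity_eq (h z : ι → ℝ) :
    shiftDensity h z = Real.exp (-∑ i, h i ^ 2 / 2) * Real.exp (∑ i, h i * z i) := by
  rw [shiftDensity, ← Real.exp_add, Finset.sum_sub_distrib]
  ring_nf

theorem integrable_shiftDensity (h : ι → ℝ) :
    Integrable (shiftDensity h) (gaussianVector ι) :=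
  ((integrable_exp_linear h).const_mul (Real.exp (-∑ i, h i ^ 2 / 2))).congr
    (Filter.Eventually.of_forall fun z => (shiftDensity_eq h z).symm)

theorem integral_shiftDensity (h : ι → ℝ) :
    ∫ z, shiftDensity h z ∂gaussianVector ι = 1 := by
  simp_rw [shiftDensity_eq]
  rw [integral_const_mul, integral_exp_linear, ← Real.exp_add, ← Finset.sum_div]
  simp

theorem shiftDensity_mul (h k z : ι → ℝ) :
    shiftDensity h z * shiftDensity k z
      = Real.exp (∑ i, h i * k i) * shiftDensity (h + k) z := by
  simp only [shiftDensity]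
  rw [← Real.exp_add, ← Real.exp_add, ← Finset.sum_add_distrib, ← Finset.sum_add_distrib]
  congr 1
  refine Finset.sum_congr rfl fun i _ => ?_
  simp only [Pi.add_apply]
  ring

theorem measureReal_add_preimage (h : ι → ℝ) {B : Set (ι → ℝ)} (hB : MeasurableSet B) :
    (gaussianVector ι).real ((fun z => z + h) ⁻¹' B)
      = ∫ z in B, shiftDensity h z ∂gaussianVector ι := by
  rw [measureReal_def, ← Measure.map_apply (by fun_prop) hB, map_add_gaussianVector,
    withDensity_apply _ hB, integral_eq_lintegral_of_nonneg_ae (f := shiftDensity h)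
      (Filter.Eventually.of_forall fun z => (Real.exp_pos _).le)
      (integrable_shiftDensity h).aestronglyMeasurable.restrict]
  rfl

/-- A uniform mixture of translates of the standard Gaussian vector is within `η` of it in total
variation as soon as its chi-square divergence is at most `η²`. -/
theorem mixture_sub_le {I : Type*} [Fintype I] [Nonempty I] (h : I → ι → ℝ) {η : ℝ} (hη : 0 < η)
    (hχ : ∑ i, ∑ j, Real.exp (∑ o, h i o * h j o) ≤ (1 + η ^ 2) * (Fintype.card I : ℝ) ^ 2)
    {B : Set (ι → ℝ)} (hB : MeasurableSet B) :
    (∑ i, (gaussianVector ι).real ((fun z => z + h i) ⁻¹' B)) / Fintype.card I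
      - (gaussianVector ι).real B ≤ η := by
  set N : ℝ := (Fintype.card I : ℝ) with hN
  have hNpos : 0 < N := by rw [hN]; exact_mod_cast Fintype.card_pos
  set g : (ι → ℝ) → ℝ := fun z => (∑ i, shiftDensity (h i) z) / N - 1 with hg
  have hgint : Integrable g (gaussianVector ι) :=
    ((integrable_finsetSum _ fun i _ => integrable_shiftDensity (h i)).div_const N).sub
      (integrable_const 1)
  have hsq : ∀ z, g z ^ 2 = (∑ i, ∑ j, Real.exp (∑ o, h i o * h j o)
      * shiftDensity (h i + h j) z) / N ^ 2 - 2 * g z - 1 := by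
    intro z
    simp_rw [← shiftDensity_mul, ← Finset.mul_sum, ← Finset.sum_mul]
    simp only [hg]
    field_simp
    ring
  have hint1 : Integrable (fun z => (∑ i, ∑ j, Real.exp (∑ o, h i o * h j o)
      * shiftDensity (h i + h j) z) / N ^ 2) (gaussianVector ι) :=
    (integrable_finsetSum _ fun i _ => integrable_finsetSum _ fun j _ =>
      (integrable_shiftDensity _).const_mul _).div_const _
  have hgsqint : Integrable (fun z => g z ^ 2) (gaussianVector ι) := by
    simp_rw [hsq]
    exact (hint1.sub (hgint.const_mul 2)).sub (integrable_const 1)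
  have hg0 : ∫ z, g z ∂gaussianVector ι = 0 := by
    simp only [hg]
    rw [integral_sub ((integrable_finsetSum _ fun i _ => integrable_shiftDensity (h i)).div_const N)
      (integrable_const 1), integral_div,
      integral_finsetSum _ fun i _ => integrable_shiftDensity (h i)]
    simp only [integral_shiftDensity, Finset.sum_const, Finset.card_univ, nsmul_eq_mul, mul_one,
      integral_const, probReal_univ, smul_eq_mul]
    rw [← hN, div_self hNpos.ne', sub_self]
  have hgsq : ∫ z, g z ^ 2 ∂gaussianVector ι ≤ η ^ 2 := by
    simp_rw [hsq]
    have hint2 : Integrable (fun z => (∑ i, ∑ j, Real.exp (∑ o, h i o * h j o)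
        * shiftDensity (h i + h j) z) / N ^ 2 - 2 * g z) (gaussianVector ι) :=
      hint1.sub (hgint.const_mul 2)
    rw [integral_sub hint2 (integrable_const 1),
      integral_sub hint1 (hgint.const_mul 2), integral_const_mul, hg0, integral_div,
      integral_finsetSum _ fun i _ => integrable_finsetSum _ fun j _ =>
        (integrable_shiftDensity _).const_mul _]
    simp_rw [integral_finsetSum _ fun j _ => (integrable_shiftDensity _).const_mul _,
      integral_const_mul, integral_shiftDensity]
    simp only [mul_one, integral_const, probReal_univ, smul_eq_mul]
    have : (∑ i, ∑ j, Real.exp (∑ o, h i o * h j o)) / N ^ 2 ≤ 1 + η ^ 2 := by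
      rw [div_le_iff₀ (by positivity)]
      exact hχ
    linarith
  have hlhs : (∑ i, (gaussianVector ι).real ((fun z => z + h i) ⁻¹' B)) / N
      - (gaussianVector ι).real B = ∫ z in B, g z ∂gaussianVector ι := by
    simp_rw [measureReal_add_preimage _ hB]
    simp only [hg]
    rw [integral_sub ((integrable_finsetSum _ fun i _ =>
        (integrable_shiftDensity (h i)).integrableOn).div_const N) (integrable_const 1),
      integral_div, integral_finsetSum _ fun i _ => (integrable_shiftDensity (h i)).integrableOn]
    simp
  rw [hlhs]
  -- Young's inequality `g ≤ (g² / η + η) / 2` replaces Cauchy–Schwarz here.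
  have hyoung : ∀ z, g z ≤ (g z ^ 2 / η + η) / 2 := by
    intro z
    have h1 : 0 ≤ (g z - η) ^ 2 / η := by positivity
    have h2 : (g z - η) ^ 2 / η = g z ^ 2 / η - 2 * g z + η := by field_simp; ring
    linarith
  have hRint : Integrable (fun z => (g z ^ 2 / η + η) / 2) (gaussianVector ι) :=
    ((hgsqint.div_const η).add (integrable_const η)).div_const 2
  calc ∫ z in B, g z ∂gaussianVector ι
      ≤ ∫ z in B, (g z ^ 2 / η + η) / 2 ∂gaussianVector ι :=
        setIntegral_mono hgint.integrableOn hRint.integrableOn hyoung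
    _ ≤ ∫ z, (g z ^ 2 / η + η) / 2 ∂gaussianVector ι :=
        setIntegral_le_integral hRint (Filter.Eventually.of_forall fun z => by
          simp only [Pi.zero_apply]; positivity)
    _ = ((∫ z, g z ^ 2 ∂gaussianVector ι) / η + η) / 2 := by
        rw [integral_div, integral_add (hgsqint.div_const η) (integrable_const η), integral_div]
        simp
    _ ≤ (η ^ 2 / η + η) / 2 := by gcongr
    _ = η := by field_simp; ring

end Mixture

section RiskBounds

variable {p s : ℕ} {γ ε : ℝ}

/-- Le Cam's method: a finite family of alternatives whose uniform mixture has chi-square divergence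
at most `η²` from the null law forces the risk above `1 - η`. -/
theorem le_risk_of_mixture {I : Type*} [Fintype I] [Nonempty I] (hγ : γ ∈ Set.Icc (0 : ℝ) 1)
    (θ : I → EuclideanSpace ℝ (Fin p)) (hθ : ∀ i, θ i ∈ alternative p s ε)
    (h : I → Option (Fin p) → ℝ) (hobs : ∀ i z, obs p γ (θ i) z = obs p γ 0 (z + h i))
    {η : ℝ} (hη : 0 < η)
    (hχ : ∑ i, ∑ j, Real.exp (∑ o, h i o * h j o) ≤ (1 + η ^ 2) * (Fintype.card I : ℝ) ^ 2) :
    ENNReal.ofReal (1 - η) ≤ risk p s γ ε := by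
  refine le_iInf₂ fun φ hφ => ?_
  set G := gaussianVector (Option (Fin p)) with hG
  have hA : MeasurableSet {x | φ x = 1} := hφ (measurableSet_singleton 1)
  have hA0 : MeasurableSet {x | φ x = 0} := hφ (measurableSet_singleton 0)
  set B := obs p γ 0 ⁻¹' {x | φ x = 1} with hBdef
  have hB : MeasurableSet B := (measurable_obs 0) hA
  have hmix := mixture_sub_le h hη hχ hB
  have hNpos : (0 : ℝ) < Fintype.card I := by exact_mod_cast Fintype.card_pos
  have hcompl : ∀ i, G.real (obs p γ (θ i) ⁻¹' {x | φ x = 0})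
      = 1 - G.real ((fun z => z + h i) ⁻¹' B) := by
    intro i
    rw [← probReal_compl_eq_one_sub ((measurable_add_const (h i)) hB)]
    congr 1
    ext z
    simp only [hBdef, Set.mem_preimage, Set.mem_ofPred_eq, Set.mem_compl_iff, hobs]
    omega
  obtain ⟨i, hi⟩ : ∃ i, 1 - η - G.real B ≤ G.real (obs p γ (θ i) ⁻¹' {x | φ x = 0}) := by
    by_contra! hcon
    have hlt : ∑ i, G.real (obs p γ (θ i) ⁻¹' {x | φ x = 0})
        < ∑ _i : I, (1 - η - G.real B) :=
      Finset.sum_lt_sum_of_nonempty Finset.univ_nonempty fun i _ => hcon i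
    simp_rw [hcompl] at hlt
    rw [Finset.sum_sub_distrib, Finset.sum_const, Finset.sum_const, Finset.card_univ,
      nsmul_eq_mul, nsmul_eq_mul, mul_one] at hlt
    have h2 : η * Fintype.card I < ∑ i, G.real ((fun z => z + h i) ⁻¹' B)
        - G.real B * Fintype.card I := by linarith
    have h3 := (sub_le_iff_le_add.mp hmix)
    rw [div_le_iff₀ hNpos] at h3
    linarith
  calc ENNReal.ofReal (1 - η)
      ≤ ENNReal.ofReal (G.real B + G.real (obs p γ (θ i) ⁻¹' {x | φ x = 0})) :=
        ENNReal.ofReal_le_ofReal (by linarith)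
    _ = law p γ 0 {x | φ x = 1} + law p γ (θ i) {x | φ x = 0} := by
        rw [ENNReal.ofReal_add measureReal_nonneg measureReal_nonneg, law_apply hγ _ hA,
          law_apply hγ _ hA0]
    _ ≤ _ := by
        gcongr
        exact le_iSup₂ (f := fun θ (_ : θ ∈ alternative p s ε) => law p γ θ {x | φ x = 0})
          (θ i) (hθ i)

/-! ### Comparison of separation rates -/

/-- Two separation rates are within a constant factor of each other, since the risk cannot be at
most `1 / 4` and at least `3 / 4` at the same separation. -/
theorem IsMinimaxSeparationRate.le_const_mul {f g : ℕ → ℕ → ℝ → ℝ}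
    (hf : IsMinimaxSeparationRate f) (hg : IsMinimaxSeparationRate g) :
    ∃ K : ℝ, 0 < K ∧ ∀ (p s : ℕ) (γ : ℝ), 1 ≤ s → s ≤ p → γ ∈ Set.Icc (0 : ℝ) 1 →
      g p s γ ≤ K * f p s γ := by
  obtain ⟨C, hC, hup⟩ := hf.2.1 (1 / 4) (by norm_num)
  obtain ⟨c, hc, hlow⟩ := hg.2.2 (1 / 4) (by norm_num)
  refine ⟨C / c, by positivity, fun p s γ hs hsp hγ => ?_⟩
  by_contra! hlt
  have h1 : C * f p s γ < c * g p s γ := by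
    rw [div_mul_eq_mul_div, div_lt_iff₀ hc] at hlt
    linarith
  obtain ⟨ε, h2, h3⟩ := exists_between h1
  have hε : 0 < ε := (mul_nonneg hC.le (hf.1 p s γ hs hsp hγ)).trans_lt h2
  have h4 := (hlow p s γ hs hsp hγ ε hε h3).trans (hup p s γ hs hsp hγ ε hε h2)
  rw [ENNReal.ofReal_le_ofReal_iff (by norm_num)] at h4
  norm_num at h4

/-! ### Upper bounds on the risk by tests -/

/-- A measurable rejection region with both errors at most `η / 2` bounds the risk by `η`. -/
theorem risk_le_of_test (hγ : γ ∈ Set.Icc (0 : ℝ) 1) {R : Set (EuclideanSpace ℝ (Fin p))}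
    (hR : MeasurableSet R) {η : ℝ} (hη : 0 ≤ η)
    (h0 : (gaussianVector (Option (Fin p))).real (obs p γ 0 ⁻¹' R) ≤ η / 2)
    (h1 : ∀ θ ∈ alternative p s ε,
      (gaussianVector (Option (Fin p))).real (obs p γ θ ⁻¹' Rᶜ) ≤ η / 2) :
    risk p s γ ε ≤ ENNReal.ofReal η := by
  classical
  refine (iInf₂_le (fun x => if x ∈ R then (1 : Fin 2) else 0)
    (Measurable.ite hR measurable_const measurable_const)).trans ?_
  have e1 : {x | (if x ∈ R then (1 : Fin 2) else 0) = 1} = R := by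
    ext x; by_cases hx : x ∈ R <;> simp [hx]
  have e0 : {x | (if x ∈ R then (1 : Fin 2) else 0) = 0} = Rᶜ := by
    ext x; by_cases hx : x ∈ R <;> simp [hx]
  rw [e1, e0]
  calc _ ≤ ENNReal.ofReal (η / 2) + ENNReal.ofReal (η / 2) := by
        gcongr
        · rw [law_apply hγ _ hR]
          exact ENNReal.ofReal_le_ofReal h0
        · refine iSup₂_le fun θ hθ => ?_
          rw [law_apply hγ _ hR.compl]
          exact ENNReal.ofReal_le_ofReal (h1 θ hθ)
    _ = ENNReal.ofReal η := by
        rw [← ENNReal.ofReal_add (by positivity) (by positivity)]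
        ring_nf

end RiskBounds

/-! ### Priors that pick one coordinate in each of `m` blocks -/

section Blocks

variable {p m b : ℕ}

/-- The indicator that `k` is the coordinate picked by `M` in block `j`, at `x = (j, k)`. -/
def pick (M : Fin m → Fin b) (x : Fin m × Fin b) : ℝ := if M x.1 = x.2 then 1 else 0

/-- The number of blocks in which `M` and `M'` pick the same coordinate. -/
def agreement (M M' : Fin m → Fin b) : ℝ := ∑ j, if M j = M' j then 1 else 0

/-- The function on `Fin p` carried by the blocks, which are embedded in `Fin p` by `e`. -/
noncomputable def onBlocks (e : Fin m × Fin b ↪ Fin p) (c : Fin m × Fin b → ℝ) (i : Fin p) : ℝ :=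
  Function.extend e c 0 i

@[simp]
theorem onBlocks_apply (e : Fin m × Fin b ↪ Fin p) (c : Fin m × Fin b → ℝ) (x : Fin m × Fin b) :
    onBlocks e c (e x) = c x :=
  e.injective.extend_apply _ _ _

theorem onBlocks_of_notMem (e : Fin m × Fin b ↪ Fin p) (c : Fin m × Fin b → ℝ) {i : Fin p}
    (hi : i ∉ Set.range e) : onBlocks e c i = 0 :=
  Function.extend_apply' _ _ _ hi

theorem sum_onBlocks (e : Fin m × Fin b ↪ Fin p) (c : Fin m × Fin b → ℝ) :
    ∑ i, onBlocks e c i = ∑ x, c x :=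
  (Fintype.sum_of_injective e e.injective c (onBlocks e c)
    (fun _ hi => onBlocks_of_notMem e c hi) fun x => (onBlocks_apply e c x).symm).symm

theorem sum_onBlocks_mul (e : Fin m × Fin b ↪ Fin p) (c d : Fin m × Fin b → ℝ) :
    ∑ i, onBlocks e c i * onBlocks e d i = ∑ x, c x * d x :=
  (Fintype.sum_of_injective e e.injective (fun x => c x * d x)
    (fun i => onBlocks e c i * onBlocks e d i)
    (fun i hi => by simp only [onBlocks_of_notMem e c hi, zero_mul])
    fun x => by simp only [onBlocks_apply]).symm

theorem sum_pick (M : Fin m → Fin b) : ∑ x, pick M x = m := by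
  simp only [Fintype.sum_prod_type, pick, Finset.sum_ite_eq, Finset.mem_univ, if_true]
  simp

theorem sum_pick_mul_pick (M M' : Fin m → Fin b) : ∑ x, pick M x * pick M' x = agreement M M' := by
  simp only [Fintype.sum_prod_type, pick, agreement]
  refine Finset.sum_congr rfl fun j _ => ?_
  simp only [ite_mul, one_mul, zero_mul, Finset.sum_ite_eq, Finset.mem_univ, if_true]
  simp only [eq_comm]

theorem sum_centered_pick (hb : 0 < b) (M : Fin m → Fin b) :
    ∑ x, (pick M x - 1 / (b : ℝ)) = 0 := by
  have : (b : ℝ) ≠ 0 := by positivity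
  rw [Finset.sum_sub_distrib, sum_pick]
  simp
  field_simp
  ring

theorem sum_centered_pick_mul (hb : 0 < b) (M M' : Fin m → Fin b) :
    ∑ x, (pick M x - 1 / (b : ℝ)) * (pick M' x - 1 / (b : ℝ)) = agreement M M' - m / b := by
  have hb' : (b : ℝ) ≠ 0 := by positivity
  have h : ∀ x, (pick M x - 1 / (b : ℝ)) * (pick M' x - 1 / (b : ℝ))
      = pick M x * pick M' x - 1 / b * pick M' x - 1 / b * (pick M x - 1 / (b : ℝ)) := by
    intro x; ring
  simp_rw [h]
  rw [Finset.sum_sub_distrib, Finset.sum_sub_distrib, ← Finset.mul_sum, ← Finset.mul_sum,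
    sum_centered_pick hb, sum_pick, sum_pick_mul_pick]
  ring

/-- The exponential moment of the overlap of two independent uniform choices: the overlap is a sum
of `m` independent Bernoulli variables with parameter `1 / b`. -/
theorem sum_exp_agreement_le (hb : 0 < b) {a D r : ℝ} (h : D + m * (Real.exp a - 1) / b ≤ r) :
    ∑ M : Fin m → Fin b, ∑ M' : Fin m → Fin b, Real.exp (D + a * agreement M M')
      ≤ Real.exp r * (Fintype.card (Fin m → Fin b) : ℝ) ^ 2 := by
  have hb' : (0 : ℝ) < b := by exact_mod_cast hb
  have hin : ∀ M : Fin m → Fin b, ∑ M' : Fin m → Fin b, Real.exp (D + a * agreement M M')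
      = Real.exp D * ((b : ℝ) - 1 + Real.exp a) ^ m := by
    intro M
    simp_rw [Real.exp_add, ← Finset.mul_sum]
    congr 1
    have h1 : ∀ M' : Fin m → Fin b, Real.exp (a * agreement M M')
        = ∏ j, (if M j = M' j then Real.exp a else 1) := by
      intro M'
      rw [agreement, Finset.mul_sum, Real.exp_sum]
      refine Finset.prod_congr rfl fun j _ => ?_
      split_ifs <;> simp
    simp_rw [h1]
    rw [← Fintype.piFinset_univ,
      ← Finset.prod_univ_sum (fun _ => Finset.univ) fun j k => if M j = k then Real.exp a else 1]
    have h2 : ∀ j, ∑ k, (if M j = k then Real.exp a else 1) = (b : ℝ) - 1 + Real.exp a := by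
      intro j
      have h3 : ∀ k, (if M j = k then Real.exp a else 1)
          = 1 + (if M j = k then Real.exp a - 1 else 0) := by
        intro k; split_ifs <;> ring
      simp_rw [h3]
      rw [Finset.sum_add_distrib, Finset.sum_ite_eq]
      simp
      ring
    simp [h2]
  simp_rw [hin]
  rw [Finset.sum_const, Finset.card_univ, nsmul_eq_mul]
  have hcard : (Fintype.card (Fin m → Fin b) : ℝ) = (b : ℝ) ^ m := by simp
  rw [hcard]
  have hbase : (b : ℝ) - 1 + Real.exp a ≤ b * Real.exp ((Real.exp a - 1) / b) := by
    have h1 := Real.add_one_le_exp ((Real.exp a - 1) / b)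
    have h2 := mul_le_mul_of_nonneg_left h1 hb'.le
    have h3 : (b : ℝ) * ((Real.exp a - 1) / b + 1) = b - 1 + Real.exp a := by field_simp; ring
    linarith
  have hb1 : (1 : ℝ) ≤ b := by exact_mod_cast hb
  calc (b : ℝ) ^ m * (Real.exp D * ((b : ℝ) - 1 + Real.exp a) ^ m)
      ≤ (b : ℝ) ^ m * (Real.exp D * (b * Real.exp ((Real.exp a - 1) / b)) ^ m) := by
        have : (0 : ℝ) ≤ (b : ℝ) - 1 + Real.exp a := by
          positivity [Real.exp_pos a, sub_nonneg.2 hb1]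
        gcongr
    _ = Real.exp (D + m * (Real.exp a - 1) / b) * ((b : ℝ) ^ m) ^ 2 := by
        rw [mul_pow, ← Real.exp_nat_mul, Real.exp_add, mul_div_assoc]
        ring
    _ ≤ _ := by gcongr

end Blocks

section Priors

variable {p s m b : ℕ} {γ ε τ η : ℝ}

theorem mem_alternative_of_sq {θ : EuclideanSpace ℝ (Fin p)} (h : ε ^ 2 ≤ ∑ i, θ i ^ 2)
    (hs : {i : Fin p | θ i ≠ 0}.ncard ≤ s) : θ ∈ alternative p s ε := by
  refine ⟨?_, hs⟩
  rw [← EuclideanSpace.real_norm_sq_eq] at h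
  exact (abs_le_of_sq_le_sq' h (norm_nonneg _)).2

/-- A mean `θ` is produced by a translation `h` of the noise vector. The split of `θ` between the
common factor and the idiosyncratic noise is free. -/
theorem obs_eq_obs_zero {θ : EuclideanSpace ℝ (Fin p)} {h : Option (Fin p) → ℝ}
    (hh : ∀ i, θ i = √γ * h none + √(1 - γ) * h (some i)) (z : Option (Fin p) → ℝ) :
    obs p γ θ z = obs p γ 0 (z + h) := by
  ext i
  simp only [obs_apply, Pi.add_apply, hh i, PiLp.zero_apply]
  ring

theorem div_sqrt_mul_div_sqrt {t : ℝ} (ht : 0 ≤ t) (x y : ℝ) : x / √t * (y / √t) = x * y / t := by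
  rw [div_mul_div_comm, Real.mul_self_sqrt ht]

theorem exp_log_one_add_sq (η : ℝ) : Real.exp (Real.log (1 + η ^ 2)) = 1 + η ^ 2 :=
  Real.exp_log (by positivity)

/-- Sparse prior: `θ = τ` on the picked coordinates and `0` elsewhere. -/
theorem le_risk_sparse (hγ : γ ∈ Set.Icc (0 : ℝ) 1) (hγ1 : γ < 1) (hb : 0 < b) (hms : m ≤ s)
    (hmb : m * b ≤ p) (hη : 0 < η) (hε : ε ^ 2 ≤ τ ^ 2 * m)
    (hχ : m * (Real.exp (τ ^ 2 / (1 - γ)) - 1) / b ≤ Real.log (1 + η ^ 2)) :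
    ENNReal.ofReal (1 - η) ≤ risk p s γ ε := by
  obtain ⟨e⟩ : Nonempty (Fin m × Fin b ↪ Fin p) :=
    Function.Embedding.nonempty_of_card_le (by simpa using hmb)
  have hσ : 0 < 1 - γ := by linarith
  have hsq : √(1 - γ) ^ 2 = 1 - γ := Real.sq_sqrt hσ.le
  have hσ' : √(1 - γ) ≠ 0 := (Real.sqrt_pos.2 hσ).ne'
  have : Nonempty (Fin b) := ⟨⟨0, hb⟩⟩
  refine le_risk_of_mixture (I := Fin m → Fin b) hγ
    (fun M => WithLp.toLp 2 fun i => τ * onBlocks e (pick M) i) (fun M => ?_)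
    (fun M o => o.elim 0 fun i => τ / √(1 - γ) * onBlocks e (pick M) i)
    (fun M => obs_eq_obs_zero fun i => ?_) hη ?_
  · refine mem_alternative_of_sq ?_ ?_
    · simp only [mul_pow, ← Finset.mul_sum]
      simp_rw [sq (onBlocks e (pick M) _)]
      rw [sum_onBlocks_mul, sum_pick_mul_pick]
      simpa [agreement] using hε
    · have hsub : {i : Fin p | τ * onBlocks e (pick M) i ≠ 0}
          ⊆ Set.range fun j => e (j, M j) := by
        intro i hi
        by_contra hcon
        refine hi ?_
        by_cases hr : i ∈ Set.range e
        · obtain ⟨⟨j, k⟩, rfl⟩ := hr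
          have : M j ≠ k := fun h => hcon ⟨j, by simp [h]⟩
          simp [pick, this]
        · simp [onBlocks_of_notMem e _ hr]
      refine (Set.ncard_le_ncard hsub (Set.toFinite _)).trans ?_
      rw [← Set.image_univ]
      exact (Set.ncard_image_le (Set.toFinite _)).trans (by simpa using hms)
  · simp only [Option.elim]
    field_simp
    ring
  · rw [← exp_log_one_add_sq η]
    refine (le_of_eq ?_).trans
      (sum_exp_agreement_le (D := 0) (a := τ ^ 2 / (1 - γ)) hb (by linarith))
    refine Finset.sum_congr rfl fun M _ => Finset.sum_congr rfl fun M' _ => ?_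
    congr 1
    rw [Fintype.sum_option, ← sum_pick_mul_pick, ← sum_onBlocks_mul e, Finset.mul_sum]
    simp only [Option.elim, mul_zero, zero_add]
    refine Finset.sum_congr rfl fun i _ => ?_
    rw [mul_mul_mul_comm, div_sqrt_mul_div_sqrt hσ.le, ← sq]

/-- The constant mean `κ 1` is produced by a translation of squared length at most `D`, either of
the common factor (by `κ / √γ`) or of the idiosyncratic noise (by `κ / √(1 - γ)` in each of the `p`
coordinates). -/
def Absorbed (p : ℕ) (γ κ D : ℝ) : Prop :=
  (0 < γ ∧ κ ^ 2 / γ ≤ D) ∨ (γ < 1 ∧ p * κ ^ 2 / (1 - γ) ≤ D)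

theorem Absorbed.mono {κ κ' D : ℝ} (h : Absorbed p γ κ D)
    (hκ : κ' ^ 2 ≤ κ ^ 2) : Absorbed p γ κ' D := by
  rcases h with ⟨h1, h2⟩ | ⟨h1, h2⟩
  · exact Or.inl ⟨h1, le_trans (by gcongr) h2⟩
  · have : 0 < 1 - γ := by linarith
    exact Or.inr ⟨h1, le_trans (by gcongr) h2⟩

/-- Constant prior: `θ = κ 1`. -/
theorem le_risk_const (hγ : γ ∈ Set.Icc (0 : ℝ) 1) {κ D : ℝ} (hη : 0 < η)
    (hε : ε ^ 2 ≤ p * κ ^ 2) (hD : Absorbed p γ κ D) (hχ : D ≤ Real.log (1 + η ^ 2)) :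
    ENNReal.ofReal (1 - η) ≤ risk p p γ ε := by
  have hmem : WithLp.toLp 2 (fun _ => κ) ∈ alternative p p ε := by
    refine mem_alternative_of_sq (by simpa using hε) ?_
    exact (Set.ncard_le_card _).trans (by simp)
  rcases hD with ⟨hγ0, hD⟩ | ⟨hγ1, hD⟩
  · have hsq : √γ ^ 2 = γ := Real.sq_sqrt hγ0.le
    have hγ' : √γ ≠ 0 := (Real.sqrt_pos.2 hγ0).ne'
    refine le_risk_of_mixture (I := Unit) hγ (fun _ => WithLp.toLp 2 fun _ => κ) (fun _ => hmem)
      (fun _ o => o.elim (κ / √γ) fun _ => 0)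
      (fun _ => obs_eq_obs_zero fun i => ?_) hη ?_
    · simp only [Option.elim]
      field_simp
      ring
    · simp only [Fintype.sum_option, Option.elim, Finset.univ_unique, Finset.sum_singleton,
        Fintype.card_unit, Nat.cast_one, one_pow, mul_one, mul_zero, Finset.sum_const_zero,
        add_zero]
      rw [← exp_log_one_add_sq η, Real.exp_le_exp]
      refine (le_of_eq ?_).trans (hD.trans hχ)
      rw [div_sqrt_mul_div_sqrt hγ0.le, ← sq]
  · have hσ : 0 < 1 - γ := by linarith
    have hsq : √(1 - γ) ^ 2 = 1 - γ := Real.sq_sqrt hσ.le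
    have hσ' : √(1 - γ) ≠ 0 := (Real.sqrt_pos.2 hσ).ne'
    refine le_risk_of_mixture (I := Unit) hγ (fun _ => WithLp.toLp 2 fun _ => κ) (fun _ => hmem)
      (fun _ o => o.elim 0 fun _ => κ / √(1 - γ))
      (fun _ => obs_eq_obs_zero fun i => ?_) hη ?_
    · simp only [Option.elim]
      field_simp
      ring
    · simp only [Fintype.sum_option, Option.elim, Finset.univ_unique, Finset.sum_singleton,
        Fintype.card_unit, Nat.cast_one, one_pow, mul_one, mul_zero, zero_add]
      rw [← exp_log_one_add_sq η, Real.exp_le_exp]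
      refine (le_of_eq ?_).trans (hD.trans hχ)
      rw [div_sqrt_mul_div_sqrt hσ.le, Finset.sum_const, Finset.card_univ, Fintype.card_fin,
        nsmul_eq_mul, ← sq, mul_div_assoc]

/-- Dense prior: `θ` vanishes on the picked coordinates, equals `τ` on the rest of the blocks and
`κ = τ (1 - 1 / b)` outside the blocks. Thus `θ` is the constant vector `κ 1`, which is absorbed,
plus a vector with mean zero on each block, and only the latter enters the overlaps. -/
theorem le_risk_dense (hγ : γ ∈ Set.Icc (0 : ℝ) 1) (hγ1 : γ < 1) (hb : 0 < b) (hms : p ≤ s + m)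
    (hmb : m * b ≤ p) (hη : 0 < η) (hε : ε ^ 2 ≤ τ ^ 2 * (m * (b - 1))) {D : ℝ}
    (hD : Absorbed p γ τ D)
    (hχ : D + m * (Real.exp (τ ^ 2 / (1 - γ)) - 1 - τ ^ 2 / (1 - γ)) / b ≤ Real.log (1 + η ^ 2)) :
    ENNReal.ofReal (1 - η) ≤ risk p s γ ε := by
  obtain ⟨e⟩ : Nonempty (Fin m × Fin b ↪ Fin p) :=
    Function.Embedding.nonempty_of_card_le (by simpa using hmb)
  have hσ : 0 < 1 - γ := by linarith
  have hsq : √(1 - γ) ^ 2 = 1 - γ := Real.sq_sqrt hσ.le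
  have hσ' : √(1 - γ) ≠ 0 := (Real.sqrt_pos.2 hσ).ne'
  have : Nonempty (Fin b) := ⟨⟨0, hb⟩⟩
  have hbR : (1 : ℝ) ≤ b := by exact_mod_cast hb
  set κ : ℝ := τ * (1 - 1 / b) with hκ
  set v : (Fin m → Fin b) → Fin p → ℝ := fun M => onBlocks e fun x => pick M x - 1 / (b : ℝ)
    with hv
  have hDκ : Absorbed p γ κ D := by
    refine hD.mono ?_
    rw [hκ, mul_pow]
    have h1 : 0 ≤ 1 - 1 / (b : ℝ) := by
      rw [sub_nonneg, div_le_one (by positivity)]; exact hbR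
    have h2 : 1 - 1 / (b : ℝ) ≤ 1 := by
      have : 0 ≤ 1 / (b : ℝ) := by positivity
      linarith
    nlinarith [sq_nonneg τ, pow_le_one₀ (n := 2) h1 h2]
  have hval : ∀ M x, κ - τ * v M (e x) = τ * (1 - pick M x) := by
    intro M x
    simp only [hv, onBlocks_apply, hκ]
    ring
  have hmem : ∀ M, WithLp.toLp 2 (fun i => κ - τ * v M i) ∈ alternative p s ε := by
    intro M
    refine mem_alternative_of_sq ?_ ?_
    · calc ε ^ 2 ≤ τ ^ 2 * (m * (b - 1)) := hε
        _ = ∑ x, (κ - τ * v M (e x)) ^ 2 := by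
          have h1 : ∀ x, (κ - τ * v M (e x)) ^ 2 = τ ^ 2 * (1 - pick M x) := by
            intro x
            rw [hval, pick]
            split_ifs <;> ring
          simp_rw [h1]
          rw [← Finset.mul_sum, Finset.sum_sub_distrib, sum_pick]
          simp
          left
          ring
        _ = ∑ i ∈ Finset.univ.map e, (κ - τ * v M i) ^ 2 := by rw [Finset.sum_map]
        _ ≤ ∑ i, (κ - τ * v M i) ^ 2 :=
          Finset.sum_le_sum_of_subset_of_nonneg (Finset.subset_univ _) fun i _ _ => sq_nonneg _
    · have hinj : Function.Injective fun j => e (j, M j) := by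
        intro j j' hjj
        exact congrArg Prod.fst (e.injective hjj)
      have hsub : {i : Fin p | κ - τ * v M i ≠ 0} ⊆ (Set.range fun j => e (j, M j))ᶜ := by
        rintro i hi ⟨j, rfl⟩
        refine hi ?_
        simp only [hval]
        simp [pick]
      refine (Set.ncard_le_ncard hsub (Set.toFinite _)).trans ?_
      rw [Set.ncard_compl, ← Set.image_univ, Set.ncard_image_of_injective _ hinj]
      simpa using hms
  have hover : ∀ M M', ∑ i, v M i * v M' i = agreement M M' - m / b := by
    intro M M'
    simp only [hv]
    rw [sum_onBlocks_mul, sum_centered_pick_mul hb]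
  have hzero : ∀ M, ∑ i, v M i = 0 := by
    intro M
    simp only [hv]
    rw [sum_onBlocks, sum_centered_pick hb]
  set a : ℝ := τ ^ 2 / (1 - γ) with ha
  -- It remains to exhibit noise shifts whose inner products are `D' + a (agreement - m / b)`.
  have key : ∀ h : (Fin m → Fin b) → Option (Fin p) → ℝ,
      (∀ M i, κ - τ * v M i = √γ * h M none + √(1 - γ) * h M (some i)) →
      ∀ D' ≤ D, (∀ M M', ∑ o, h M o * h M' o = D' + a * (agreement M M' - m / b)) →
      ENNReal.ofReal (1 - η) ≤ risk p s γ ε := by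
    intro h hh D' hD' hin
    refine le_risk_of_mixture (I := Fin m → Fin b) hγ _ hmem h
      (fun M => obs_eq_obs_zero fun i => hh M i) hη ?_
    rw [← exp_log_one_add_sq η]
    refine (le_of_eq ?_).trans
      (sum_exp_agreement_le (D := D' - a * (m / b)) (a := a) hb ?_)
    · refine Finset.sum_congr rfl fun M _ => Finset.sum_congr rfl fun M' _ => ?_
      rw [hin]
      congr 1
      ring
    · have : m * (Real.exp a - 1 - a) / b = m * (Real.exp a - 1) / b - a * (m / b) := by ring
      linarith
  rcases hDκ with ⟨hγ0, hD1⟩ | ⟨-, hD1⟩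
  · have hsqγ : √γ ^ 2 = γ := Real.sq_sqrt hγ0.le
    have hγ' : √γ ≠ 0 := (Real.sqrt_pos.2 hγ0).ne'
    refine key (fun M o => o.elim (κ / √γ) fun i => -(τ / √(1 - γ)) * v M i) ?_ _ hD1 ?_
    · intro M i
      simp only [Option.elim]
      field_simp
      ring
    · intro M M'
      rw [Fintype.sum_option, ← hover, Finset.mul_sum]
      simp only [Option.elim]
      congr 1
      · rw [div_sqrt_mul_div_sqrt hγ0.le, ← sq]
      · refine Finset.sum_congr rfl fun i _ => ?_
        rw [mul_mul_mul_comm, neg_mul_neg, div_sqrt_mul_div_sqrt hσ.le, ← sq]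
  · refine key (fun M o => o.elim 0 fun i => (κ - τ * v M i) / √(1 - γ)) ?_ _ hD1 ?_
    · intro M i
      simp only [Option.elim]
      field_simp
      ring
    · intro M M'
      rw [Fintype.sum_option, ← hover]
      simp only [Option.elim]
      have h1 : ∀ i, (κ - τ * v M i) / √(1 - γ) * ((κ - τ * v M' i) / √(1 - γ))
          = κ ^ 2 / (1 - γ) - κ * τ / (1 - γ) * v M i - κ * τ / (1 - γ) * v M' i
            + a * (v M i * v M' i) := by
        intro i
        rw [div_sqrt_mul_div_sqrt hσ.le, ha]
        ring
      simp_rw [h1]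
      rw [Finset.sum_add_distrib, Finset.sum_sub_distrib, Finset.sum_sub_distrib,
        ← Finset.mul_sum, ← Finset.mul_sum, ← Finset.mul_sum, hzero, hzero]
      simp
      ring

end Priors

/-! ### The lower bound at the rate -/

section Lower

theorem exp_le_one_add_mul {a c x : ℝ} (hc0 : 0 ≤ c) (hc1 : c ≤ 1) (hx : 0 ≤ x)
    (h : a ≤ c * Real.log (1 + x)) : Real.exp a ≤ 1 + c * x := by
  have h1 : Real.exp (c * Real.log (1 + x)) = (1 + x) ^ c := by
    rw [Real.rpow_def_of_pos (by linarith), mul_comm]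
  exact (Real.exp_le_exp.2 h).trans
    (h1.le.trans (rpow_one_add_le_one_add_mul_self (by linarith) hc0 hc1))

theorem rpow_three_halves {x : ℝ} (hx : 0 ≤ x) : x ^ (3 / 2 : ℝ) = x * √x := by
  rcases hx.eq_or_lt with rfl | hx
  · simp
  · rw [Real.sqrt_eq_rpow, ← Real.rpow_one_add' hx.le (by norm_num)]
    norm_num

/-- The block length `b = ⌊p / m⌋` exhausts at least half of the coordinates. -/
theorem exists_block_length {p m : ℕ} (hm : 1 ≤ m) (hmp : m ≤ p) :
    ∃ b : ℕ, 0 < b ∧ m * b ≤ p ∧ p ≤ 2 * (m * b) ∧ (2 * m ≤ p → 2 ≤ b) := by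
  refine ⟨p / m, Nat.div_pos hmp hm, Nat.mul_div_le p m, ?_, fun h => ?_⟩
  · have h1 := Nat.lt_mul_div_succ p hm
    have h2 : m * 1 ≤ m * (p / m) := Nat.mul_le_mul_left _ (Nat.div_pos hmp hm)
    rw [mul_add] at h1
    omega
  · rw [Nat.le_div_iff_mul_le hm]
    exact h

variable {p s m : ℕ} {γ ε η c : ℝ}

theorem absorbed_of_le (hγ : γ ∈ Set.Icc (0 : ℝ) 1) (hp : 1 ≤ p) (hc : 0 ≤ c) {κ : ℝ}
    (hκ : κ ^ 2 ≤ 4 * ε ^ 2 / p) (hε : ε ^ 2 ≤ c * (1 - γ + γ * p)) :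
    Absorbed p γ κ (8 * c) := by
  have hp' : (1 : ℝ) ≤ p := by exact_mod_cast hp
  have hpκ : p * κ ^ 2 ≤ 4 * ε ^ 2 := by
    rw [le_div_iff₀ (by positivity)] at hκ
    linarith
  rcases le_or_gt (1 - γ) (γ * p) with h | h
  · have hγ0 : 0 < γ := by
      by_contra hcon
      have : γ = 0 := le_antisymm (not_lt.1 hcon) hγ.1
      rw [this] at h
      linarith
    refine Or.inl ⟨hγ0, ?_⟩
    rw [div_le_iff₀ hγ0]
    have h1 : p * κ ^ 2 ≤ p * (8 * c * γ) := by nlinarith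
    exact le_of_mul_le_mul_left h1 (by positivity)
  · have hγ1 : 0 < 1 - γ := lt_of_le_of_lt (by have := hγ.1; positivity) h
    refine Or.inr ⟨by linarith, ?_⟩
    rw [div_le_iff₀ hγ1]
    nlinarith

theorem le_risk_of_le_sparse (hγ : γ ∈ Set.Icc (0 : ℝ) 1) (hγ1 : γ < 1) (hm : 1 ≤ m) (hms : m ≤ s)
    (hsp : s ≤ p) (hη : 0 < η) (hc0 : 0 ≤ c) (hc1 : c ≤ 1) (hcη : 16 * c ≤ Real.log (1 + η ^ 2))
    (hε : ε ^ 2 ≤ c * ((1 - γ) * m * Real.log (1 + (p : ℝ) / (m : ℝ) ^ 2))) :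
    ENNReal.ofReal (1 - η) ≤ risk p s γ ε := by
  obtain ⟨b, hb, hmb, hpb, -⟩ := exists_block_length hm (hms.trans hsp)
  have hσ : 0 < 1 - γ := by linarith
  have hm' : (0 : ℝ) < m := by exact_mod_cast hm
  have hb' : (0 : ℝ) < b := by exact_mod_cast hb
  have hpb' : (p : ℝ) ≤ 2 * (m * b) := by exact_mod_cast hpb
  have hτ : (ε / √m) ^ 2 = ε ^ 2 / m := by rw [div_pow, Real.sq_sqrt hm'.le]
  refine le_risk_sparse (τ := ε / √m) hγ hγ1 hb hms hmb hη ?_ ?_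
  · rw [hτ, div_mul_cancel₀ _ hm'.ne']
  · have ha : (ε / √m) ^ 2 / (1 - γ) ≤ c * Real.log (1 + (p : ℝ) / (m : ℝ) ^ 2) := by
      rw [hτ, div_div, div_le_iff₀ (by positivity)]
      linarith
    have he := exp_le_one_add_mul hc0 hc1 (by positivity) ha
    calc _ ≤ m * (c * ((p : ℝ) / (m : ℝ) ^ 2)) / b := by gcongr; linarith
      _ = c * (p / (m * b)) := by field_simp
      _ ≤ c * 2 := by
        gcongr
        rw [div_le_iff₀ (by positivity)]
        exact hpb'
      _ ≤ _ := by linarith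

/-- The part of the rate contributed by the energy of the projected signal, for `s ≥ √p`. -/
theorem le_risk_of_le_sqrt (hγ : γ ∈ Set.Icc (0 : ℝ) 1) (hγ1 : γ < 1) (hs : 1 ≤ s) (hsp : s ≤ p)
    (hps : √(p : ℝ) ≤ s) (hη : 0 < η) (hc0 : 0 ≤ c) (hc1 : c ≤ 1)
    (hcη : 16 * c ≤ Real.log (1 + η ^ 2)) (hε : ε ^ 2 ≤ c / 4 * ((1 - γ) * √(p : ℝ))) :
    ENNReal.ofReal (1 - η) ≤ risk p s γ ε := by
  have hp : 1 ≤ p := hs.trans hsp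
  have hσ : 0 < 1 - γ := by linarith
  have hm : 1 ≤ Nat.sqrt p := Nat.sqrt_pos.2 hp
  have hm' : (1 : ℝ) ≤ Nat.sqrt p := by exact_mod_cast hm
  have hms : Nat.sqrt p ≤ s := by
    have : ((Nat.sqrt p : ℕ) : ℝ) ≤ s := (Real.nat_sqrt_le_real_sqrt).trans hps
    exact_mod_cast this
  refine le_risk_of_le_sparse hγ hγ1 hm hms hsp hη hc0 hc1 hcη (hε.trans ?_)
  have h1 : √(p : ℝ) ≤ 2 * Nat.sqrt p := by
    have := Real.real_sqrt_le_nat_sqrt_succ (a := p)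
    linarith
  have h2 : 1 / 2 ≤ Real.log (1 + (p : ℝ) / (Nat.sqrt p : ℝ) ^ 2) := by
    have h3 : 1 ≤ (p : ℝ) / (Nat.sqrt p : ℝ) ^ 2 := by
      rw [one_le_div (by positivity)]
      exact_mod_cast Nat.sqrt_le' p
    have h4 : Real.log 2 ≤ Real.log (1 + (p : ℝ) / (Nat.sqrt p : ℝ) ^ 2) :=
      Real.log_le_log (by norm_num) (by linarith)
    linarith [Real.log_two_gt_d9]
  calc c / 4 * ((1 - γ) * √(p : ℝ)) ≤ c / 4 * ((1 - γ) * (2 * Nat.sqrt p)) := by gcongr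
    _ = c * ((1 - γ) * Nat.sqrt p * (1 / 2)) := by ring
    _ ≤ _ := by gcongr

/-- The part of the rate contributed by the dense prior, where `m = p - s` coordinates vanish. -/
theorem le_risk_of_le_dense (hγ : γ ∈ Set.Icc (0 : ℝ) 1) (hγ1 : γ < 1) (hm : 1 ≤ m)
    (hms : p = s + m) (hmp : 2 * m ≤ p) (hη : 0 < η) (hc0 : 0 ≤ c) (hc1 : 4 * c ≤ 1)
    (hcη : 16 * c ≤ Real.log (1 + η ^ 2)) (hεV : ε ^ 2 ≤ c * (1 - γ + γ * p))
    (hε : (√(p : ℝ) ≤ m ∧ ε ^ 2 ≤ c * ((1 - γ) * (p * √(p : ℝ)) / m)) ∨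
      ε ^ 2 ≤ c * ((1 - γ) * p * Real.log (1 + (p : ℝ) / (m : ℝ) ^ 2))) :
    ENNReal.ofReal (1 - η) ≤ risk p s γ ε := by
  obtain ⟨b, hb, hmb, hpb, hb2⟩ := exists_block_length hm (by omega : m ≤ p)
  have hb2 : (2 : ℝ) ≤ b := by exact_mod_cast hb2 hmp
  have hσ : 0 < 1 - γ := by linarith
  have hm' : (0 : ℝ) < m := by exact_mod_cast hm
  have hp' : (0 : ℝ) < p := by exact_mod_cast (by omega : 0 < p)
  have hpb' : (p : ℝ) ≤ 2 * (m * b) := by exact_mod_cast hpb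
  have hτ : (2 * ε / √p) ^ 2 = 4 * ε ^ 2 / p := by
    rw [div_pow, Real.sq_sqrt hp'.le]
    ring
  have hfrac : (p : ℝ) / (m * b) ≤ 2 := by
    rw [div_le_iff₀ (by positivity)]
    exact hpb'
  refine le_risk_dense (τ := 2 * ε / √p) hγ hγ1 hb hms.le hmb hη ?_
    (absorbed_of_le hγ (by omega) hc0 hτ.le hεV) ?_
  · rw [hτ, div_mul_eq_mul_div, le_div_iff₀ hp', mul_comm (4 : ℝ), mul_assoc]
    gcongr
    nlinarith
  rw [hτ]
  set a := 4 * ε ^ 2 / p / (1 - γ) with ha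
  have ha0 : 0 ≤ a := by positivity
  have key : m * (Real.exp a - 1 - a) / b ≤ 8 * c := by
    rcases hε with ⟨hpm, hε⟩ | hε
    · have ha1 : a ≤ 4 * c * (√(p : ℝ) / m) := by
        rw [ha, div_div, div_le_iff₀ (by positivity)]
        calc 4 * ε ^ 2 ≤ 4 * (c * ((1 - γ) * (p * √(p : ℝ)) / m)) := by gcongr
          _ = _ := by ring
      have ha2 : a ≤ 1 := by
        refine ha1.trans ?_
        have : √(p : ℝ) / m ≤ 1 := by rw [div_le_one hm']; exact hpm
        exact mul_le_one₀ hc1 (by positivity) this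
      have he := Real.abs_exp_sub_one_sub_id_le (x := a) (by rwa [abs_of_nonneg ha0])
      calc m * (Real.exp a - 1 - a) / b ≤ m * (4 * c * (√(p : ℝ) / m)) ^ 2 / b := by
            gcongr
            exact (le_abs_self _).trans (he.trans (by gcongr))
        _ = 4 * c * (4 * c) * (p / (m * b)) := by
            rw [mul_pow, div_pow, Real.sq_sqrt hp'.le]
            field_simp
        _ ≤ 4 * c * 1 * 2 := by gcongr
        _ = 8 * c := by ring
    · have ha1 : a ≤ 4 * c * Real.log (1 + (p : ℝ) / (m : ℝ) ^ 2) := by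
        rw [ha, div_div, div_le_iff₀ (by positivity)]
        linarith
      have he := exp_le_one_add_mul (by positivity) hc1 (by positivity) ha1
      calc m * (Real.exp a - 1 - a) / b ≤ m * (4 * c * ((p : ℝ) / (m : ℝ) ^ 2)) / b := by
            gcongr
            linarith
        _ = 4 * c * (p / (m * b)) := by field_simp
        _ ≤ 4 * c * 2 := by gcongr
        _ = 8 * c := by ring
  linarith

theorem rate_lower_bound (hη : 0 < η) :
    ∃ c : ℝ, 0 < c ∧ ∀ (p s : ℕ) (γ : ℝ), 1 ≤ s → s ≤ p → γ ∈ Set.Icc (0 : ℝ) 1 →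
      ∀ ε : ℝ, 0 < ε → ε < c * √(rateSq p s γ) → ENNReal.ofReal (1 - η) ≤ risk p s γ ε := by
  have hlog : 0 < Real.log (1 + η ^ 2) := Real.log_pos (by nlinarith)
  set c₀ : ℝ := min (1 / 4) (Real.log (1 + η ^ 2) / 16) with hc₀
  have hpos : 0 < c₀ := by positivity
  have hc4 : 4 * c₀ ≤ 1 := by linarith [min_le_left (1 / 4) (Real.log (1 + η ^ 2) / 16)]
  have hc1 : c₀ ≤ 1 := by linarith
  have hcη : 16 * c₀ ≤ Real.log (1 + η ^ 2) := by
    linarith [min_le_right (1 / 4) (Real.log (1 + η ^ 2) / 16)]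
  refine ⟨c₀ / 4, by positivity, fun p s γ hs hsp hγ ε hε hlt => ?_⟩
  have hr : 0 < rateSq p s γ := by
    by_contra hcon
    rw [Real.sqrt_eq_zero_of_nonpos (not_lt.1 hcon)] at hlt
    linarith
  -- The factor `1 / 64` comes from `(c₀ / 4) ^ 2` and `c₀ ≤ 1 / 4`. It pays for
  -- `A + B ≤ 3 * A` below.
  have hsq : ε ^ 2 ≤ c₀ / 64 * rateSq p s γ := by
    have h1 : ε ^ 2 ≤ (c₀ / 4 * √(rateSq p s γ)) ^ 2 := by gcongr
    rw [mul_pow, Real.sq_sqrt hr.le] at h1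
    refine h1.trans ?_
    gcongr
    nlinarith
  have hp' : (1 : ℝ) ≤ p := by exact_mod_cast hs.trans hsp
  have hσ0 : 0 ≤ 1 - γ := by linarith [hγ.2]
  have hV : 0 ≤ 1 - γ + γ * p := by have := hγ.1; positivity
  have hε2 : 0 < ε ^ 2 := by positivity
  set A := (1 - γ) * √(p : ℝ) with hA
  have hA0 : 0 ≤ A := by positivity
  have hγ1_of : 0 < A → γ < 1 := by
    intro h
    by_contra hcon
    have : 1 - γ = 0 := le_antisymm (by linarith) hσ0
    rw [hA, this, zero_mul] at h
    exact h.false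
  -- The rate is a sum `A + B` for `s ≥ √p`. Unless `B` exceeds `2 * A`, the term `A` determines it.
  have hfirst : ∀ B : ℝ, rateSq p s γ = A + B → √(p : ℝ) ≤ s → B ≤ 2 * A →
      ENNReal.ofReal (1 - η) ≤ risk p s γ ε := by
    intro B hB hps hBA
    rw [hB] at hsq hr
    exact le_risk_of_le_sqrt hγ (hγ1_of (by linarith)) hs hsp hps hη hpos.le hc1 hcη
      (by nlinarith)
  unfold rateSq at hsq hr hfirst
  split_ifs at hsq hr hfirst with h1 h2 h3
  · have hγ1 : γ < 1 := by
      by_contra hcon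
      have : 1 - γ = 0 := le_antisymm (by linarith) hσ0
      simp [this] at hr
    refine le_risk_of_le_sparse hγ hγ1 hs le_rfl hsp hη hpos.le hc1 hcη (hsq.trans ?_)
    gcongr
    linarith
  · have hps := not_lt.1 h1
    rcases le_or_gt (min ((1 - γ) * (p : ℝ) ^ (3 / 2 : ℝ) / ((p : ℝ) - s)) (1 - γ + γ * p)) (2 * A)
      with hB | hB
    · exact hfirst _ rfl hps hB
    have hm0 : 0 < (p : ℝ) - s := by
      have : 0 < √(p : ℝ) := Real.sqrt_pos.2 (by linarith)
      linarith
    have hlt' : s < p := by exact_mod_cast (sub_pos.1 hm0)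
    have hcast : ((p - s : ℕ) : ℝ) = (p : ℝ) - s := by push_cast [hsp]; ring
    have hsq' : ε ^ 2 ≤ c₀ * min ((1 - γ) * (p : ℝ) ^ (3 / 2 : ℝ) / ((p : ℝ) - s))
        (1 - γ + γ * p) := by nlinarith
    have hB1 := hB.trans_le (min_le_left _ _)
    rw [rpow_three_halves (by linarith)] at hB1 hsq'
    have hγ1 : γ < 1 := by
      by_contra hcon
      have h0 : 1 - γ = 0 := le_antisymm (by linarith) hσ0
      simp only [h0, zero_mul, zero_div] at hB1
      linarith
    -- The blocks need length at least `2`. Otherwise `p - s > p / 2` and `B` is at most `2 * A`.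
    have hhalf : 2 * (p - s) ≤ p := by
      have : 2 * ((p : ℝ) - s) ≤ p := by
        rw [lt_div_iff₀ hm0] at hB1
        have h4 : A * (2 * ((p : ℝ) - s)) < A * p := by
          calc A * (2 * ((p : ℝ) - s)) = 2 * A * ((p : ℝ) - s) := by ring
            _ < (1 - γ) * (p * √(p : ℝ)) := hB1
            _ = A * p := by rw [hA]; ring
        exact (lt_of_mul_lt_mul_left h4 hA0).le
      rw [← hcast] at this
      exact_mod_cast this
    refine le_risk_of_le_dense (m := p - s) hγ hγ1 (by omega) (by omega) hhalf hη hpos.le hc4 hcη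
      (hsq'.trans ?_) (Or.inl ⟨?_, ?_⟩)
    · gcongr
      exact min_le_right _ _
    · rw [hcast]; linarith
    · rw [hcast]
      refine hsq'.trans ?_
      gcongr
      exact min_le_left _ _
  · have hps := not_lt.1 h1
    rcases le_or_gt (min ((1 - γ) * p * Real.log (1 + (p : ℝ) / ((p : ℝ) - s) ^ 2))
      (1 - γ + γ * p)) (2 * A) with hB | hB
    · exact hfirst _ rfl hps hB
    have hcast : ((p - s : ℕ) : ℝ) = (p : ℝ) - s := by push_cast [hsp]; ring
    have hsq' : ε ^ 2 ≤ c₀ * min ((1 - γ) * p * Real.log (1 + (p : ℝ) / ((p : ℝ) - s) ^ 2))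
        (1 - γ + γ * p) := by nlinarith
    have hB1 := hB.trans_le (min_le_left _ _)
    have hγ1 : γ < 1 := by
      by_contra hcon
      have h0 : 1 - γ = 0 := le_antisymm (by linarith) hσ0
      simp only [h0, zero_mul] at hB1
      linarith
    have hhalf : 2 * (p - s) ≤ p := by
      have : (p : ℝ) < s + s := by linarith [not_le.1 h2]
      have : p < s + s := by exact_mod_cast this
      omega
    refine le_risk_of_le_dense (m := p - s) hγ hγ1 (by omega) (by omega) hhalf hη hpos.le hc4 hcη
      (hsq'.trans ?_) (Or.inr ?_)
    · gcongr
      exact min_le_right _ _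
    · rw [hcast]
      refine hsq'.trans ?_
      gcongr
      exact min_le_left _ _
  · have hps := not_lt.1 h1
    obtain rfl : s = p := le_antisymm hsp (not_lt.1 h3)
    rcases le_or_gt (1 - γ + γ * s) (2 * A) with hB | hB
    · exact hfirst _ rfl hps hB
    have hκ : (ε / √s) ^ 2 = ε ^ 2 / s := by rw [div_pow, Real.sq_sqrt (by linarith)]
    refine le_risk_const (κ := ε / √s) (D := 8 * c₀) hγ hη ?_ ?_ (by linarith)
    · rw [hκ, mul_div_cancel₀ _ (by positivity)]
    · refine absorbed_of_le (ε := ε) hγ hs hpos.le ?_ (by nlinarith)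
      rw [hκ]
      gcongr
      linarith

end Lower

/-! ### The test based on the sample mean and the chi-square test -/

section Tests

variable {p : ℕ} {γ : ℝ}

/-- The deviation `x i - x̄` from the mean of the coordinates. -/
noncomputable def dev (x : Fin p → ℝ) (i : Fin p) : ℝ := x i - (∑ j, x j) / p

@[fun_prop]
theorem measurable_dev (i : Fin p) : Measurable fun x : Fin p → ℝ => dev x i := by
  unfold dev
  fun_prop

theorem sum_dev (hp : 0 < p) (x : Fin p → ℝ) : ∑ i, dev x i = 0 := by
  have : (p : ℝ) ≠ 0 := by positivity
  simp only [dev, Finset.sum_sub_distrib, Finset.sum_const, Finset.card_univ, Fintype.card_fin,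
    nsmul_eq_mul]
  field_simp
  ring

theorem sum_dev_mul (hp : 0 < p) (x y : Fin p → ℝ) :
    ∑ i, dev x i * dev y i = ∑ i, x i * y i - (∑ i, x i) * (∑ i, y i) / p := by
  have h : ∀ i, dev x i * dev y i = dev x i * y i - (∑ j, y j) / p * dev x i := by
    intro i
    rw [dev, dev]
    ring
  have h2 : ∀ i, dev x i * y i = x i * y i - (∑ j, x j) / p * y i := by
    intro i
    rw [dev]
    ring
  simp_rw [h]
  rw [Finset.sum_sub_distrib, ← Finset.mul_sum, sum_dev hp]
  simp_rw [h2]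
  rw [Finset.sum_sub_distrib, ← Finset.mul_sum]
  ring

theorem sum_dev_sq (hp : 0 < p) (x : Fin p → ℝ) :
    ∑ i, dev x i ^ 2 = ∑ i, x i ^ 2 - (∑ i, x i) ^ 2 / p := by
  simp_rw [sq]
  exact sum_dev_mul hp x x

/-- The idiosyncratic noise, without the common factor. -/
def idio (z : Option (Fin p) → ℝ) (i : Fin p) : ℝ := z (some i)

@[fun_prop]
theorem measurable_idio : Measurable (idio : (Option (Fin p) → ℝ) → Fin p → ℝ) := by
  unfold idio
  fun_prop

/-- The deviations from the mean do not depend on the common factor. -/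
theorem dev_obs (hp : 0 < p) (θ : EuclideanSpace ℝ (Fin p)) (z : Option (Fin p) → ℝ) (i : Fin p) :
    dev (obs p γ θ z) i = dev θ i + √(1 - γ) * dev (idio z) i := by
  have : (p : ℝ) ≠ 0 := by positivity
  simp only [dev, obs_apply, idio, Finset.sum_add_distrib, Finset.sum_const, Finset.card_univ,
    Fintype.card_fin, nsmul_eq_mul, ← Finset.mul_sum]
  field_simp
  ring

theorem measureReal_idio_linear_le (a : Fin p → ℝ) {t δ : ℝ} (ht : 0 < t)
    (h : ∑ i, a i ^ 2 ≤ δ * t ^ 2) :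
    (gaussianVector (Option (Fin p))).real {z | t ≤ |∑ i, a i * idio z i|} ≤ δ := by
  have := measureReal_linear_le (ι := Option (Fin p)) (fun o => o.elim 0 a) ht
    (by simpa [Fintype.sum_option] using h)
  simpa [Fintype.sum_option, idio] using this

/-- The rejection region of the test based on the sample mean. -/
def meanRegion (p : ℕ) (γ K : ℝ) : Set (EuclideanSpace ℝ (Fin p)) :=
  {x | K * √(p * (1 - γ + γ * p)) < |∑ i, x i|}

theorem measurableSet_meanRegion (K : ℝ) : MeasurableSet (meanRegion p γ K) :=
  measurableSet_lt measurable_const (by fun_prop)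

theorem variance_pos (hγ : γ ∈ Set.Icc (0 : ℝ) 1) (hp : 0 < p) : 0 < 1 - γ + γ * p := by
  have hp' : (1 : ℝ) ≤ p := by exact_mod_cast hp
  nlinarith [hγ.1]

theorem sum_obs (θ : EuclideanSpace ℝ (Fin p)) (z : Option (Fin p) → ℝ) :
    ∑ i, obs p γ θ z i
      = ∑ i, θ i + ∑ o, (o.elim (p * √γ) fun _ => √(1 - γ)) * z o := by
  simp only [obs_apply, Finset.sum_add_distrib, Fintype.sum_option, Option.elim, ← Finset.mul_sum,
    Finset.sum_const, Finset.card_univ, Fintype.card_fin, nsmul_eq_mul]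
  ring

theorem measureReal_sum_noise_le (hγ : γ ∈ Set.Icc (0 : ℝ) 1) (hp : 0 < p) {K : ℝ} (hK : 0 < K) :
    (gaussianVector (Option (Fin p))).real {z | K * √(p * (1 - γ + γ * p))
      ≤ |∑ o, (o.elim (p * √γ) fun _ => √(1 - γ)) * z o|} ≤ 1 / K ^ 2 := by
  have hV := variance_pos hγ hp
  have hp' : (0 : ℝ) < p := by exact_mod_cast hp
  refine measureReal_linear_le _ (by positivity) (le_of_eq ?_)
  rw [mul_pow, Real.sq_sqrt (by positivity), Fintype.sum_option]
  simp only [Option.elim, mul_pow, Real.sq_sqrt hγ.1, Real.sq_sqrt (sub_nonneg.2 hγ.2),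
    Finset.sum_const, Finset.card_univ, Fintype.card_fin, nsmul_eq_mul]
  field_simp
  ring

theorem meanRegion_null (hγ : γ ∈ Set.Icc (0 : ℝ) 1) (hp : 0 < p) {K : ℝ} (hK : 0 < K) :
    (gaussianVector (Option (Fin p))).real (obs p γ 0 ⁻¹' meanRegion p γ K) ≤ 1 / K ^ 2 := by
  refine (measureReal_mono ?_).trans (measureReal_sum_noise_le hγ hp hK)
  intro z hz
  simp only [meanRegion, Set.mem_preimage, Set.mem_ofPred_eq, sum_obs, PiLp.zero_apply,
    Finset.sum_const_zero, zero_add] at hz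
  exact hz.le

theorem meanRegion_alt (hγ : γ ∈ Set.Icc (0 : ℝ) 1) (hp : 0 < p) {K : ℝ} (hK : 0 < K)
    {θ : EuclideanSpace ℝ (Fin p)}
    (hθ : 4 * K ^ 2 * (1 - γ + γ * p) < (∑ i, θ i) ^ 2 / p) :
    (gaussianVector (Option (Fin p))).real (obs p γ θ ⁻¹' (meanRegion p γ K)ᶜ) ≤ 1 / K ^ 2 := by
  refine (measureReal_mono ?_).trans (measureReal_sum_noise_le hγ hp hK)
  have hV := variance_pos hγ hp
  have hp' : (0 : ℝ) < p := by exact_mod_cast hp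
  have h2 : 2 * (K * √(p * (1 - γ + γ * p))) < |∑ i, θ i| := by
    refine lt_of_pow_lt_pow_left₀ 2 (abs_nonneg _) ?_
    rw [sq_abs, mul_pow, mul_pow, Real.sq_sqrt (by positivity)]
    rw [lt_div_iff₀ hp'] at hθ
    linarith
  intro z hz
  simp only [meanRegion, Set.mem_preimage, Set.mem_compl_iff, Set.mem_ofPred_eq, sum_obs,
    not_lt] at hz ⊢
  have := abs_sub_abs_le_abs_sub (∑ i, θ i)
    (-∑ o : Option (Fin p), (o.elim (p * √γ) fun _ => √(1 - γ)) * z o)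
  rw [sub_neg_eq_add, abs_neg] at this
  linarith

theorem memLp_sq_sub_one : MemLp (fun x : ℝ => x ^ 2 - 1) 2 (gaussianReal 0 1) := by
  refine MemLp.sub ?_ (memLp_const 1)
  refine (memLp_two_iff_integrable_sq (by fun_prop)).2 ?_
  have := (memLp_id_gaussianReal (μ := 0) (v := 1) 4).integrable_norm_pow'
  refine this.congr (Filter.Eventually.of_forall fun x => ?_)
  simp only [id, Real.norm_eq_abs]
  rw [← pow_mul]
  exact Even.pow_abs (by decide) x

/-- The variance of the square of a standard normal variable. -/
noncomputable def varSq : ℝ := Var[fun x : ℝ => x ^ 2 - 1; gaussianReal 0 1]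

theorem measureReal_chiSq_le (hp : 0 < p) {K : ℝ} (hK : 0 < K) :
    (gaussianVector (Option (Fin p))).real {z | K * √p ≤ |∑ i, (idio z i ^ 2 - 1)|}
      ≤ varSq / K ^ 2 := by
  have hp' : (0 : ℝ) < p := by exact_mod_cast hp
  set X : Option (Fin p) → ℝ → ℝ := fun o => o.elim (fun _ => 0) fun _ x => x ^ 2 - 1 with hX
  have hmem : ∀ o, MemLp (X o) 2 (gaussianReal 0 1) := by
    intro o
    cases o with
    | none => exact memLp_const 0
    | some i => exact memLp_sq_sub_one
  have hfun : (∑ o, fun z : Option (Fin p) → ℝ => X o (z o))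
      = fun z => ∑ i, (idio z i ^ 2 - 1) := by
    ext z
    simp [hX, Fintype.sum_option, idio]
  have hv := variance_sum_pi (μ := fun _ : Option (Fin p) => gaussianReal 0 1) hmem
  have hmean : ∀ o, ∫ x, X o x ∂gaussianReal 0 1 = 0 := by
    intro o
    cases o with
    | none => simp [hX]
    | some i =>
      have h1 := variance_of_integral_eq_zero (μ := gaussianReal 0 1) (X := fun x : ℝ => x)
        (by fun_prop) (by simp)
      rw [variance_fun_id_gaussianReal] at h1
      simp only [hX, Option.elim]
      have h2 : Integrable (fun x : ℝ => x ^ 2) (gaussianReal 0 1) :=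
        (memLp_id_gaussianReal 2).integrable_sq
      rw [integral_sub h2 (integrable_const 1), ← h1]
      simp
  have hcomp : ∀ o, MemLp (fun z : Option (Fin p) → ℝ => X o (z o)) 2 (gaussianVector _) :=
    fun o => (hmem o).comp_measurePreserving
      (measurePreserving_eval (fun _ : Option (Fin p) => gaussianReal 0 1) o)
  have hmemS : MemLp (fun z : Option (Fin p) → ℝ => ∑ i, (idio z i ^ 2 - 1)) 2
      (gaussianVector _) := by
    rw [← hfun]
    exact memLp_finsetSum' _ fun o _ => hcomp o
  have hzero : ∫ z, ∑ i, (idio z i ^ 2 - 1) ∂gaussianVector (Option (Fin p)) = 0 := by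
    have h1 : ∀ z : Option (Fin p) → ℝ, ∑ i, (idio z i ^ 2 - 1) = ∑ o, X o (z o) := by
      intro z
      simp [hX, Fintype.sum_option, idio]
    simp_rw [h1]
    rw [integral_finsetSum _ fun o _ => (hcomp o).integrable (by norm_num)]
    refine Finset.sum_eq_zero fun o _ => ?_
    rw [integral_comp_eval (μ := fun _ : Option (Fin p) => gaussianReal 0 1)
      (hmem o).aestronglyMeasurable]
    exact hmean o
  rw [hfun, variance_of_integral_eq_zero hmemS.aestronglyMeasurable.aemeasurable hzero] at hv
  refine measureReal_le_of_sq hmemS.integrable_sq (by positivity) (le_of_eq ?_)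
  rw [hv, Fintype.sum_option]
  simp only [hX, Option.elim, Finset.sum_const, Finset.card_univ, Fintype.card_fin, nsmul_eq_mul]
  have hv0 : Var[fun _ : ℝ => (0 : ℝ); gaussianReal 0 1] = 0 := by
    rw [variance_of_integral_eq_zero aemeasurable_const (by simp)]
    simp
  rw [hv0, mul_pow, Real.sq_sqrt hp'.le, varSq]
  field_simp
  ring

/-- The rejection region of the chi-square test on the deviations from the mean. -/
def chiRegion (p : ℕ) (γ K : ℝ) : Set (EuclideanSpace ℝ (Fin p)) :=
  {x | (1 - γ) * (p + K * √p) < ∑ i, dev x i ^ 2}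

theorem measurableSet_chiRegion (K : ℝ) : MeasurableSet (chiRegion p γ K) := by
  refine measurableSet_lt measurable_const ?_
  refine Finset.measurable_sum _ fun i _ => Measurable.pow_const ?_ 2
  exact (measurable_dev i).comp (by fun_prop)

theorem chiRegion_null (hγ : γ ∈ Set.Icc (0 : ℝ) 1) (hp : 0 < p) {K : ℝ} (hK : 0 < K) :
    (gaussianVector (Option (Fin p))).real (obs p γ 0 ⁻¹' chiRegion p γ K) ≤ varSq / K ^ 2 := by
  refine (measureReal_mono ?_).trans (measureReal_chiSq_le hp hK)
  have hp' : (0 : ℝ) < p := by exact_mod_cast hp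
  have hσ : 0 ≤ 1 - γ := sub_nonneg.2 hγ.2
  intro z hz
  have h0 : ∀ i, dev (0 : EuclideanSpace ℝ (Fin p)) i = 0 := by simp [dev]
  simp only [chiRegion, Set.mem_preimage, Set.mem_ofPred_eq, dev_obs hp, h0, zero_add, mul_pow,
    ← Finset.mul_sum, Real.sq_sqrt hσ] at hz
  rw [sum_dev_sq hp] at hz
  have h1 := lt_of_mul_lt_mul_left hz hσ
  have h2 : 0 ≤ (∑ i, idio z i) ^ 2 / p := by positivity
  have h3 : ∑ i, (idio z i ^ 2 - 1) = ∑ i, idio z i ^ 2 - p := by simp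
  rw [Set.mem_ofPred_eq, h3]
  exact le_trans (by linarith) (le_abs_self _)

theorem chiRegion_alt (hγ : γ ∈ Set.Icc (0 : ℝ) 1) (hp : 0 < p) {K : ℝ} (hK : 1 ≤ K)
    {θ : EuclideanSpace ℝ (Fin p)}
    (hθ : 16 * K ^ 2 * ((1 - γ) * √p) < ∑ i, dev θ i ^ 2) :
    (gaussianVector (Option (Fin p))).real (obs p γ θ ⁻¹' (chiRegion p γ K)ᶜ)
      ≤ (varSq + 2) / K ^ 2 := by
  have hp' : (1 : ℝ) ≤ p := by exact_mod_cast hp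
  have hK0 : 0 < K := by linarith
  have hσ : 0 ≤ 1 - γ := sub_nonneg.2 hγ.2
  set t := √(1 - γ) with ht
  have ht0 : 0 ≤ t := Real.sqrt_nonneg _
  have htsq : 1 - γ = t ^ 2 := (Real.sq_sqrt hσ).symm
  set w := √(p : ℝ) with hw
  have hw1 : 1 ≤ w := Real.one_le_sqrt.2 hp'
  have hwsq : w ^ 2 = p := Real.sq_sqrt (by linarith)
  set r := √(∑ i, dev θ i ^ 2) with hr
  have hrsq : r ^ 2 = ∑ i, dev θ i ^ 2 :=
    Real.sq_sqrt (Finset.sum_nonneg fun i _ => sq_nonneg _)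
  rw [htsq, ← hrsq] at hθ
  have hr0 : 0 < r := by
    refine lt_of_le_of_ne (Real.sqrt_nonneg _) fun h => ?_
    rw [← h] at hθ
    have : 0 ≤ 16 * K ^ 2 * (t ^ 2 * w) := by positivity
    linarith
  have h4 : 4 * K * t ≤ r := by
    refine (abs_le_of_sq_le_sq' (le_trans ?_ hθ.le) hr0.le).2
    calc (4 * K * t) ^ 2 = 16 * K ^ 2 * (t ^ 2 * 1) := by ring
      _ ≤ _ := by gcongr
  have hsub : obs p γ θ ⁻¹' (chiRegion p γ K)ᶜ ⊆
      {z | K * √p ≤ |∑ i, (idio z i ^ 2 - 1)|} ∪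
        ({z | K * w ≤ |∑ i, (fun _ => 1) i * idio z i|} ∪
          {z | K * r ≤ |∑ i, dev θ i * idio z i|}) := by
    intro z hz
    by_contra hcon
    simp only [Set.mem_union, Set.mem_ofPred_eq, not_or, not_le, one_mul] at hcon
    obtain ⟨c1, c2, c3⟩ := hcon
    refine hz ?_
    have hexp : ∑ i, dev (obs p γ θ z) i ^ 2 = r ^ 2 + 2 * t * ∑ i, dev θ i * idio z i
        + t ^ 2 * (∑ i, idio z i ^ 2 - (∑ i, idio z i) ^ 2 / p) := by
      have h1 : ∀ i, dev (obs p γ θ z) i ^ 2 = dev θ i ^ 2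
          + 2 * t * (dev θ i * dev (idio z) i) + t ^ 2 * dev (idio z) i ^ 2 := by
        intro i
        rw [dev_obs hp]
        ring
      have h2 : ∑ i, dev θ i * dev (idio z) i = ∑ i, dev θ i * idio z i := by
        have h3 : ∀ i, dev θ i * dev (idio z) i
            = dev θ i * idio z i - (∑ j, idio z j) / p * dev θ i := by
          intro i
          rw [dev.eq_def (idio z)]
          ring
        simp_rw [h3]
        rw [Finset.sum_sub_distrib, ← Finset.mul_sum, sum_dev hp]
        ring
      simp_rw [h1]
      rw [Finset.sum_add_distrib, Finset.sum_add_distrib, ← Finset.mul_sum, ← Finset.mul_sum, h2,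
        sum_dev_sq hp (idio z), hrsq]
    have e1 : ∑ i, (idio z i ^ 2 - 1) = ∑ i, idio z i ^ 2 - p := by simp
    rw [e1] at c1
    have e2 : (∑ i, idio z i) ^ 2 / p ≤ K ^ 2 := by
      rw [div_le_iff₀ (by linarith), ← hwsq, ← mul_pow, ← sq_abs]
      exact pow_le_pow_left₀ (abs_nonneg _) c2.le 2
    have e3 : -(K * r) ≤ ∑ i, dev θ i * idio z i := (abs_lt.1 c3).1.le
    have e4 : p - K * w - K ^ 2 ≤ ∑ i, idio z i ^ 2 - (∑ i, idio z i) ^ 2 / p := by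
      linarith [(abs_lt.1 c1).1]
    change (1 - γ) * (p + K * √p) < _
    rw [hexp, htsq]
    have e5 : 2 * t * (-(K * r)) ≤ 2 * t * ∑ i, dev θ i * idio z i := by gcongr
    have e6 := mul_le_mul_of_nonneg_left e4 (sq_nonneg t)
    have e7 : 4 * K * t * r ≤ r ^ 2 := by nlinarith
    have e8 : t ^ 2 * (2 * (K * w) + K ^ 2) ≤ 3 * K ^ 2 * (t ^ 2 * w) := by
      have : 2 * (K * w) + K ^ 2 ≤ 3 * K ^ 2 * w := by
        nlinarith [mul_le_mul_of_nonneg_right hK (by positivity : 0 ≤ K * w), sq_nonneg K]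
      calc _ ≤ t ^ 2 * (3 * K ^ 2 * w) := by gcongr
        _ = _ := by ring
    have e9 : 0 ≤ K ^ 2 * (t ^ 2 * w) := by positivity
    nlinarith
  have b1 := measureReal_chiSq_le hp hK0
  have b2 := measureReal_idio_linear_le (p := p) (fun _ => 1) (t := K * w) (δ := 1 / K ^ 2)
    (by positivity) (by
      rw [mul_pow, hwsq]
      simp
      field_simp
      rfl)
  have b3 := measureReal_idio_linear_le (p := p) (dev θ) (t := K * r) (δ := 1 / K ^ 2)
    (by positivity) (by
      rw [mul_pow, hrsq]
      field_simp
      rfl)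
  calc _ ≤ _ := measureReal_mono hsub
    _ ≤ varSq / K ^ 2 + (1 / K ^ 2 + 1 / K ^ 2) :=
      (measureReal_union_le _ _).trans
        (add_le_add b1 ((measureReal_union_le _ _).trans (add_le_add b2 b3)))
    _ = _ := by ring

end Tests

/-! ### The hyperbolic cosine test -/

section CoshMoments

variable {ι : Type*} [Fintype ι]

theorem cosh_mul_cosh_linear (a a' : ι → ℝ) (b b' : ℝ) (z : ι → ℝ) :
    Real.cosh (b + ∑ i, a i * z i) * Real.cosh (b' + ∑ i, a' i * z i)
      = (Real.cosh ((b + b') + ∑ i, (a + a') i * z i)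
        + Real.cosh ((b - b') + ∑ i, (a - a') i * z i)) / 2 := by
  simp only [Pi.add_apply, Pi.sub_apply, add_mul, sub_mul, Finset.sum_add_distrib,
    Finset.sum_sub_distrib]
  rw [show b + b' + (∑ i, a i * z i + ∑ i, a' i * z i)
      = (b + ∑ i, a i * z i) + (b' + ∑ i, a' i * z i) by ring,
    show b - b' + (∑ i, a i * z i - ∑ i, a' i * z i)
      = (b + ∑ i, a i * z i) - (b' + ∑ i, a' i * z i) by ring,
    Real.cosh_add (b + ∑ i, a i * z i), Real.cosh_sub (b + ∑ i, a i * z i)]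
  ring

theorem integrable_cosh_mul_cosh (a a' : ι → ℝ) (b b' : ℝ) :
    Integrable (fun z : ι → ℝ => Real.cosh (b + ∑ i, a i * z i)
      * Real.cosh (b' + ∑ i, a' i * z i)) (gaussianVector ι) := by
  simp_rw [cosh_mul_cosh_linear]
  exact ((integrable_cosh_linear _ _).add (integrable_cosh_linear _ _)).div_const 2

theorem integral_cosh_mul_cosh (a a' : ι → ℝ) (b b' : ℝ) :
    ∫ z, Real.cosh (b + ∑ i, a i * z i) * Real.cosh (b' + ∑ i, a' i * z i) ∂gaussianVector ι
      = (Real.exp ((∑ i, (a i + a' i) ^ 2) / 2) * Real.cosh (b + b')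
        + Real.exp ((∑ i, (a i - a' i) ^ 2) / 2) * Real.cosh (b - b')) / 2 := by
  simp_rw [cosh_mul_cosh_linear]
  rw [integral_div, integral_add (integrable_cosh_linear _ _) (integrable_cosh_linear _ _),
    integral_cosh_linear, integral_cosh_linear]
  simp only [Pi.add_apply, Pi.sub_apply]

end CoshMoments

section CoshTest

variable {p : ℕ} {γ : ℝ}

/-- The coefficients of `z i - z̄` as a linear form in the noise. -/
noncomputable def devCoef (i : Fin p) (o : Option (Fin p)) : ℝ :=
  o.elim 0 fun j => (if i = j then 1 else 0) - 1 / p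

theorem sum_devCoef_mul (i : Fin p) (z : Option (Fin p) → ℝ) :
    ∑ o, devCoef i o * z o = dev (idio z) i := by
  simp only [Fintype.sum_option, devCoef, Option.elim, zero_mul, zero_add, sub_mul,
    Finset.sum_sub_distrib, ite_mul, one_mul, Finset.sum_ite_eq, Finset.mem_univ, if_true,
    ← Finset.mul_sum, dev, idio]
  ring

theorem sum_devCoef_mul_devCoef (hp : 0 < p) (i j : Fin p) :
    ∑ o, devCoef i o * devCoef j o = (if i = j then 1 else 0) - 1 / (p : ℝ) := by
  have hp' : (p : ℝ) ≠ 0 := by positivity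
  simp only [Fintype.sum_option, devCoef, Option.elim, zero_mul, zero_add, sub_mul,
    Finset.sum_sub_distrib, ite_mul, one_mul, Finset.sum_ite_eq, Finset.mem_univ, if_true,
    ← Finset.mul_sum, Finset.sum_const, Finset.card_univ, Fintype.card_fin, nsmul_eq_mul]
  rw [mul_one_div_cancel hp', sub_self, mul_zero, sub_zero]
  simp only [eq_comm]

/-- Half the variance of `l * (z i - z̄)`. -/
noncomputable def halfVar (p : ℕ) (l : ℝ) : ℝ := l ^ 2 * (1 - 1 / (p : ℝ)) / 2

/-- The centred summand of the hyperbolic cosine statistic at a coordinate with mean `b i`. -/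
noncomputable def coshTerm (l : ℝ) (b : Fin p → ℝ) (i : Fin p) (z : Option (Fin p) → ℝ) : ℝ :=
  Real.cosh (l * (b i + dev (idio z) i)) - Real.exp (halfVar p l) * Real.cosh (l * b i)

theorem cosh_eq_linear (l : ℝ) (b : Fin p → ℝ) (i : Fin p) (z : Option (Fin p) → ℝ) :
    Real.cosh (l * (b i + dev (idio z) i))
      = Real.cosh (l * b i + ∑ o, (l * devCoef i o) * z o) := by
  simp_rw [mul_assoc]
  rw [← Finset.mul_sum, sum_devCoef_mul, mul_add]

theorem halfVar_nonneg (hp : 0 < p) (l : ℝ) : 0 ≤ halfVar p l := by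
  have : 0 ≤ 1 - 1 / (p : ℝ) := by
    rw [sub_nonneg, div_le_one (by positivity)]
    exact_mod_cast hp
  unfold halfVar
  positivity

theorem halfVar_le (l : ℝ) : halfVar p l ≤ l ^ 2 / 2 := by
  have : 0 ≤ l ^ 2 * (1 / (p : ℝ)) := by positivity
  unfold halfVar
  linarith

theorem integral_cosh_dev (hp : 0 < p) (l : ℝ) (b : Fin p → ℝ) (i : Fin p) :
    ∫ z, Real.cosh (l * (b i + dev (idio z) i)) ∂gaussianVector (Option (Fin p))
      = Real.exp (halfVar p l) * Real.cosh (l * b i) := by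
  simp_rw [cosh_eq_linear]
  rw [integral_cosh_linear]
  simp only [mul_pow, ← Finset.mul_sum, halfVar]
  simp_rw [sq (devCoef i _)]
  rw [sum_devCoef_mul_devCoef hp, if_pos rfl]

theorem integrable_cosh_dev (l : ℝ) (b : Fin p → ℝ) (i : Fin p) :
    Integrable (fun z => Real.cosh (l * (b i + dev (idio z) i)))
      (gaussianVector (Option (Fin p))) := by
  simp_rw [cosh_eq_linear]
  exact integrable_cosh_linear _ _

theorem integrable_coshTerm_mul (l : ℝ) (b : Fin p → ℝ) (i j : Fin p) :
    Integrable (fun z => coshTerm l b i z * coshTerm l b j z)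
      (gaussianVector (Option (Fin p))) := by
  have h1 : Integrable (fun z => Real.cosh (l * (b i + dev (idio z) i))
      * Real.cosh (l * (b j + dev (idio z) j))) (gaussianVector (Option (Fin p))) := by
    simp_rw [cosh_eq_linear]
    exact integrable_cosh_mul_cosh _ _ _ _
  refine ((h1.sub ((integrable_cosh_dev l b i).const_mul
    (Real.exp (halfVar p l) * Real.cosh (l * b j)))).sub ((integrable_cosh_dev l b j).const_mul
    (Real.exp (halfVar p l) * Real.cosh (l * b i)))).add (integrable_const
    (Real.exp (halfVar p l) * Real.cosh (l * b i) * (Real.exp (halfVar p l) * Real.cosh (l * b j))))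
    |>.congr (Filter.Eventually.of_forall fun z => ?_)
  simp only [coshTerm, Pi.add_apply, Pi.sub_apply]
  ring

theorem integral_coshTerm_mul (hp : 0 < p) (l : ℝ) (b : Fin p → ℝ) (i j : Fin p) :
    ∫ z, coshTerm l b i z * coshTerm l b j z ∂gaussianVector (Option (Fin p))
      = Real.exp (2 * halfVar p l) / 2 *
        ((Real.exp (l ^ 2 * ((if i = j then 1 else 0) - 1 / (p : ℝ))) - 1)
            * Real.cosh (l * b i + l * b j)
          + (Real.exp (-(l ^ 2 * ((if i = j then 1 else 0) - 1 / (p : ℝ)))) - 1)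
            * Real.cosh (l * b i - l * b j)) := by
  set G := gaussianVector (Option (Fin p)) with hG
  set e := Real.exp (halfVar p l) with he
  have h1 : Integrable (fun z => Real.cosh (l * (b i + dev (idio z) i))
      * Real.cosh (l * (b j + dev (idio z) j))) G := by
    simp_rw [cosh_eq_linear]
    exact integrable_cosh_mul_cosh _ _ _ _
  have h2 : ∀ z, coshTerm l b i z * coshTerm l b j z
      = Real.cosh (l * (b i + dev (idio z) i)) * Real.cosh (l * (b j + dev (idio z) j))
        - (e * Real.cosh (l * b j) * Real.cosh (l * (b i + dev (idio z) i))
          + e * Real.cosh (l * b i) * Real.cosh (l * (b j + dev (idio z) j))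
          - e * Real.cosh (l * b i) * (e * Real.cosh (l * b j))) := by
    intro z
    simp only [coshTerm, ← he]
    ring
  have h3 : Integrable (fun z => e * Real.cosh (l * b j) * Real.cosh (l * (b i + dev (idio z) i))
      + e * Real.cosh (l * b i) * Real.cosh (l * (b j + dev (idio z) j))) G :=
    ((integrable_cosh_dev l b i).const_mul _).add ((integrable_cosh_dev l b j).const_mul _)
  have h4 : Integrable (fun z => e * Real.cosh (l * b j) * Real.cosh (l * (b i + dev (idio z) i))
      + e * Real.cosh (l * b i) * Real.cosh (l * (b j + dev (idio z) j))
      - e * Real.cosh (l * b i) * (e * Real.cosh (l * b j))) G := h3.sub (integrable_const _)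
  simp_rw [h2]
  rw [integral_sub h1 h4, integral_sub h3 (integrable_const _),
    integral_add ((integrable_cosh_dev l b i).const_mul _)
      ((integrable_cosh_dev l b j).const_mul _), integral_const_mul, integral_const_mul,
    integral_cosh_dev hp, integral_cosh_dev hp]
  simp_rw [cosh_eq_linear]
  rw [integral_cosh_mul_cosh]
  have hself : ∀ k : Fin p, ∑ o, devCoef k o ^ 2 = 1 - 1 / (p : ℝ) := by
    intro k
    simp_rw [sq]
    rw [sum_devCoef_mul_devCoef hp, if_pos rfl]
  have hplus : (∑ o, (l * devCoef i o + l * devCoef j o) ^ 2) / 2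
      = 2 * halfVar p l + l ^ 2 * ((if i = j then 1 else 0) - 1 / (p : ℝ)) := by
    rw [← sum_devCoef_mul_devCoef hp i j]
    have : ∀ o, (l * devCoef i o + l * devCoef j o) ^ 2
        = l ^ 2 * devCoef i o ^ 2 + l ^ 2 * devCoef j o ^ 2
          + 2 * l ^ 2 * (devCoef i o * devCoef j o) := fun o => by ring
    simp_rw [this]
    rw [Finset.sum_add_distrib, Finset.sum_add_distrib, ← Finset.mul_sum, ← Finset.mul_sum,
      ← Finset.mul_sum, hself, hself, halfVar]
    ring
  have hminus : (∑ o, (l * devCoef i o - l * devCoef j o) ^ 2) / 2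
      = 2 * halfVar p l + -(l ^ 2 * ((if i = j then 1 else 0) - 1 / (p : ℝ))) := by
    rw [← sum_devCoef_mul_devCoef hp i j]
    have : ∀ o, (l * devCoef i o - l * devCoef j o) ^ 2
        = l ^ 2 * devCoef i o ^ 2 + l ^ 2 * devCoef j o ^ 2
          - 2 * l ^ 2 * (devCoef i o * devCoef j o) := fun o => by ring
    simp_rw [this]
    rw [Finset.sum_sub_distrib, Finset.sum_add_distrib, ← Finset.mul_sum, ← Finset.mul_sum,
      ← Finset.mul_sum, hself, hself, halfVar]
    ring
  rw [hplus, hminus, Real.exp_add, Real.exp_add, two_mul, Real.exp_add, ← he, Real.cosh_add,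
    Real.cosh_sub]
  simp only [integral_const, probReal_univ, smul_eq_mul]
  ring

/-- The noise coordinates are negatively correlated, so that the covariances are of order
`l ^ 2 / p` and add up to no more than the variances. -/
theorem integral_coshTerm_mul_le (hp : 0 < p) {l : ℝ} (hl : l ^ 2 ≤ p) {b : Fin p → ℝ} {i j : Fin p}
    (hi : |l * b i| ≤ 1) (hj : |l * b j| ≤ 1) :
    ∫ z, coshTerm l b i z * coshTerm l b j z ∂gaussianVector (Option (Fin p))
      ≤ (if i = j then Real.cosh 2 * Real.exp (l ^ 2) ^ 2 else 0)
        + Real.cosh 2 * Real.exp (l ^ 2) * (l ^ 2 / p) := by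
  have hp' : (0 : ℝ) < p := by exact_mod_cast hp
  have h2q : 2 * halfVar p l ≤ l ^ 2 := by linarith [halfVar_le (p := p) l]
  have hq0 := halfVar_nonneg hp l
  rw [abs_le] at hi hj
  have hc1 : Real.cosh (l * b i + l * b j) ≤ Real.cosh 2 := by
    rw [Real.cosh_le_cosh, abs_of_pos (by norm_num : (0 : ℝ) < 2), abs_le]
    constructor <;> linarith
  have hc2 : Real.cosh (l * b i - l * b j) ≤ Real.cosh 2 := by
    rw [Real.cosh_le_cosh, abs_of_pos (by norm_num : (0 : ℝ) < 2), abs_le]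
    constructor <;> linarith
  have hp1 := Real.cosh_pos (l * b i + l * b j)
  have hp2 := Real.cosh_pos (l * b i - l * b j)
  have hC := Real.cosh_pos 2
  have hrest : 0 ≤ Real.cosh 2 * Real.exp (l ^ 2) * (l ^ 2 / p) := by positivity
  rw [integral_coshTerm_mul hp]
  by_cases hij : i = j
  · simp only [if_pos hij]
    have e1 : l ^ 2 * (1 - 1 / (p : ℝ)) = 2 * halfVar p l := by unfold halfVar; ring
    rw [e1]
    have e2 : Real.exp (-(2 * halfVar p l)) ≤ 1 := Real.exp_le_one_iff.2 (by linarith)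
    have e3 : Real.exp (2 * halfVar p l) ≤ Real.exp (l ^ 2) := Real.exp_le_exp.2 h2q
    have e4 : (Real.exp (2 * halfVar p l) - 1) * Real.cosh (l * b i + l * b j)
        + (Real.exp (-(2 * halfVar p l)) - 1) * Real.cosh (l * b i - l * b j)
        ≤ Real.exp (l ^ 2) * Real.cosh 2 := by
      have := mul_le_mul e3 hc1 hp1.le (Real.exp_pos _).le
      nlinarith
    have e5 : 0 ≤ Real.exp (l ^ 2) * Real.cosh 2 := by positivity
    calc _ ≤ Real.exp (2 * halfVar p l) / 2 * (Real.exp (l ^ 2) * Real.cosh 2) := by gcongr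
      _ ≤ Real.exp (l ^ 2) * (Real.exp (l ^ 2) * Real.cosh 2) := by
        gcongr
        linarith [Real.exp_pos (2 * halfVar p l)]
      _ ≤ _ := by linarith
  · simp only [if_neg hij]
    have e1 : l ^ 2 * (0 - 1 / (p : ℝ)) = -(l ^ 2 / p) := by ring
    rw [e1, neg_neg, zero_add]
    have hh : 0 ≤ l ^ 2 / p := by positivity
    have hh1 : l ^ 2 / p ≤ 1 := by rw [div_le_one hp']; exact hl
    have e2 : Real.exp (-(l ^ 2 / p)) ≤ 1 := Real.exp_le_one_iff.2 (by linarith)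
    have e3 : Real.exp (l ^ 2 / p) - 1 ≤ 2 * (l ^ 2 / p) := by
      have := Real.abs_exp_sub_one_le (x := l ^ 2 / p) (by rwa [abs_of_nonneg hh])
      rw [abs_of_nonneg hh] at this
      exact (le_abs_self _).trans this
    have e4 : (Real.exp (-(l ^ 2 / p)) - 1) * Real.cosh (l * b i + l * b j)
        + (Real.exp (l ^ 2 / p) - 1) * Real.cosh (l * b i - l * b j)
        ≤ 2 * (l ^ 2 / p) * Real.cosh 2 := by
      have := mul_le_mul e3 hc2 hp2.le (by positivity)
      nlinarith
    calc _ ≤ Real.exp (2 * halfVar p l) / 2 * (2 * (l ^ 2 / p) * Real.cosh 2) := by gcongr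
      _ ≤ Real.exp (l ^ 2) / 2 * (2 * (l ^ 2 / p) * Real.cosh 2) := by gcongr
      _ = _ := by ring

theorem measureReal_sum_coshTerm_le (hp : 0 < p) {l : ℝ} (hl : l ^ 2 ≤ p) {b : Fin p → ℝ}
    {L : Finset (Fin p)} (hL : ∀ i ∈ L, |l * b i| ≤ 1) {K : ℝ} (hK : 0 < K) :
    (gaussianVector (Option (Fin p))).real
      {z | K * √p * Real.exp (l ^ 2) ≤ |∑ i ∈ L, coshTerm l b i z|} ≤ 2 * Real.cosh 2 / K ^ 2 := by
  have hp' : (0 : ℝ) < p := by exact_mod_cast hp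
  have hexp : ∀ z, (∑ i ∈ L, coshTerm l b i z) ^ 2
      = ∑ i ∈ L, ∑ j ∈ L, coshTerm l b i z * coshTerm l b j z := fun z => by
    rw [sq, Finset.sum_mul_sum]
  have hint := fun i j => integrable_coshTerm_mul (p := p) l b i j
  refine measureReal_le_of_sq ?_ (by positivity) ?_
  · simp_rw [hexp]
    exact integrable_finsetSum _ fun i _ => integrable_finsetSum _ fun j _ => hint i j
  · simp_rw [hexp]
    rw [integral_finsetSum _ fun i _ => integrable_finsetSum _ fun j _ => hint i j]
    simp_rw [integral_finsetSum _ fun j _ => hint _ j]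
    set E := Real.exp (l ^ 2) with hE
    have hE0 : 0 < E := Real.exp_pos _
    have hlE : l ^ 2 ≤ E := by linarith [Real.add_one_le_exp (l ^ 2)]
    have hLp : (L.card : ℝ) ≤ p := by
      have := L.card_le_univ
      rw [Fintype.card_fin] at this
      exact_mod_cast this
    have hC := Real.cosh_pos 2
    calc ∑ i ∈ L, ∑ j ∈ L, ∫ z, coshTerm l b i z * coshTerm l b j z
          ∂gaussianVector (Option (Fin p))
        ≤ ∑ i ∈ L, ∑ j ∈ L, ((if i = j then Real.cosh 2 * E ^ 2 else 0)
          + Real.cosh 2 * E * (l ^ 2 / p)) :=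
          Finset.sum_le_sum fun i hi => Finset.sum_le_sum fun j hj =>
            integral_coshTerm_mul_le hp hl (hL i hi) (hL j hj)
      _ = L.card * (Real.cosh 2 * E ^ 2)
          + L.card * (L.card * (Real.cosh 2 * E * (l ^ 2 / p))) := by
          simp only [Finset.sum_add_distrib, Finset.sum_ite_eq, Finset.sum_const, nsmul_eq_mul]
          congr 1
          rw [Finset.sum_congr rfl fun i hi => if_pos hi, Finset.sum_const, nsmul_eq_mul]
      _ ≤ p * (Real.cosh 2 * E ^ 2) + p * (p * (Real.cosh 2 * E * (E / p))) := by gcongr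
      _ = 2 * Real.cosh 2 / K ^ 2 * (K * √p * E) ^ 2 := by
          rw [mul_pow, mul_pow, Real.sq_sqrt hp'.le]
          field_simp
          ring

/-- The rejection region of the hyperbolic cosine test on the deviations from the mean. -/
def coshRegion (p : ℕ) (γ l K : ℝ) : Set (EuclideanSpace ℝ (Fin p)) :=
  {x | p * Real.exp (halfVar p l) + K * √p * Real.exp (l ^ 2)
    < ∑ i, Real.cosh (l * (dev x i / √(1 - γ)))}

theorem measurableSet_coshRegion (l K : ℝ) : MeasurableSet (coshRegion p γ l K) := by
  refine measurableSet_lt measurable_const ?_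
  refine Finset.measurable_sum _ fun i _ => Real.measurable_cosh.comp ?_
  exact (((measurable_dev i).comp (by fun_prop)).div_const _).const_mul _

theorem dev_obs_div (hp : 0 < p) (hγ1 : γ < 1) (θ : EuclideanSpace ℝ (Fin p))
    (z : Option (Fin p) → ℝ) (i : Fin p) :
    dev (obs p γ θ z) i / √(1 - γ) = dev θ i / √(1 - γ) + dev (idio z) i := by
  have : √(1 - γ) ≠ 0 := (Real.sqrt_pos.2 (by linarith)).ne'
  rw [dev_obs hp]
  field_simp

theorem coshRegion_null (hp : 0 < p) (hγ1 : γ < 1) {l : ℝ} (hl : l ^ 2 ≤ p) {K : ℝ} (hK : 0 < K) :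
    (gaussianVector (Option (Fin p))).real (obs p γ 0 ⁻¹' coshRegion p γ l K)
      ≤ 2 * Real.cosh 2 / K ^ 2 := by
  refine (measureReal_mono ?_).trans (measureReal_sum_coshTerm_le hp hl (b := fun _ => 0)
    (L := Finset.univ) (fun i _ => by simp) hK)
  intro z hz
  have h0 : ∀ i, dev (0 : EuclideanSpace ℝ (Fin p)) i = 0 := by simp [dev]
  simp only [coshRegion, Set.mem_preimage, Set.mem_ofPred_eq, dev_obs_div hp hγ1, h0, zero_div,
    zero_add] at hz
  simp only [Set.mem_ofPred_eq, coshTerm, mul_zero, Real.cosh_zero, mul_one, zero_add,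
    Finset.sum_sub_distrib, Finset.sum_const, Finset.card_univ, Fintype.card_fin, nsmul_eq_mul]
  exact le_trans (by linarith) (le_abs_self _)

theorem measureReal_dev_le (hp : 0 < p) (i : Fin p) {K : ℝ} (hK : 0 < K) :
    (gaussianVector (Option (Fin p))).real {z | K ≤ |dev (idio z) i|} ≤ 1 / K ^ 2 := by
  have := measureReal_linear_le (devCoef i) (t := K) (δ := 1 / K ^ 2) hK (by
    simp_rw [sq (devCoef i _)]
    rw [sum_devCoef_mul_devCoef hp, if_pos rfl, one_div_mul_cancel (by positivity)]
    have : 0 ≤ 1 / (p : ℝ) := by positivity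
    linarith)
  simpa only [sum_devCoef_mul] using this

theorem half_exp_le_cosh (x : ℝ) : Real.exp |x| / 2 ≤ Real.cosh x := by
  rw [← Real.cosh_abs, Real.cosh_eq]
  linarith [Real.exp_pos (-|x|)]

/-- Power of the hyperbolic cosine test. The coordinates in `G` carry the signal. Markov's
inequality applied to the weights of those coordinates of `G` whose noise exceeds `K` shows that `G`
contributes a fixed fraction of its total weight, with no moment of heavy terms involved. The
remaining coordinates with `l * |b i| ≤ 1` contribute their mean up to Chebyshev fluctuations, and
there are few coordinates with `l * |b i| > 1`. -/
theorem coshRegion_alt (hp : 0 < p) (hγ1 : γ < 1) {l : ℝ} (hl0 : 0 ≤ l) (hl : l ^ 2 ≤ p) {K C m : ℝ}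
    (hK : 0 < K) {θ : EuclideanSpace ℝ (Fin p)}
    (hθ : ∑ i, (dev θ i / √(1 - γ)) ^ 2 ≤ C * √p) {G : Finset (Fin p)} (hG : (G.card : ℝ) ≤ m)
    (hW : 2 * (K * √p * Real.exp (l ^ 2)) + (l ^ 2 * (C * √p) + m) * Real.exp (halfVar p l)
      ≤ Real.exp (-(l * K)) / 4 * ∑ i ∈ G, Real.exp (l * |dev θ i / √(1 - γ)|)) :
    (gaussianVector (Option (Fin p))).real (obs p γ θ ⁻¹' (coshRegion p γ l K)ᶜ)
      ≤ (2 * Real.cosh 2 + 2) / K ^ 2 := by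
  classical
  have hp' : (0 : ℝ) < p := by exact_mod_cast hp
  set P := gaussianVector (Option (Fin p)) with hP
  set b : Fin p → ℝ := fun i => dev θ i / √(1 - γ) with hb
  set W := ∑ i ∈ G, Real.exp (l * |b i|) with hWdef
  have hθ' : ∑ i, b i ^ 2 ≤ C * √p := hθ
  have hC0 : 0 ≤ C * √p := (Finset.sum_nonneg fun i _ => sq_nonneg (b i)).trans hθ'
  have hm0 : 0 ≤ m := (Nat.cast_nonneg _).trans hG
  have hWpos : 0 < W := by
    have h1 : 0 < 2 * (K * √p * Real.exp (l ^ 2)) := by positivity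
    have h2 : 0 ≤ (l ^ 2 * (C * √p) + m) * Real.exp (halfVar p l) := by positivity
    have h3 : 0 < Real.exp (-(l * K)) / 4 * W := by linarith
    exact pos_of_mul_pos_right h3 (by positivity)
  set H : Finset (Fin p) := Finset.univ.filter fun i => 1 < |l * b i| with hH
  set L : Finset (Fin p) := Finset.univ \ (H ∪ G) with hL
  have hLprop : ∀ i ∈ L, |l * b i| ≤ 1 := by
    intro i hi
    simp only [hL, hH, Finset.mem_sdiff, Finset.mem_union, Finset.mem_filter, Finset.mem_univ,
      true_and, not_or, not_lt] at hi
    exact hi.1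
  have hHcard : (H.card : ℝ) ≤ l ^ 2 * (C * √p) := by
    calc (H.card : ℝ) = ∑ i ∈ H, (1 : ℝ) := by simp
      _ ≤ ∑ i ∈ H, l ^ 2 * b i ^ 2 := by
        refine Finset.sum_le_sum fun i hi => ?_
        rw [← mul_pow, ← sq_abs]
        exact one_le_pow₀ (Finset.mem_filter.1 hi).2.le
      _ ≤ ∑ i, l ^ 2 * b i ^ 2 :=
        Finset.sum_le_sum_of_subset_of_nonneg (Finset.subset_univ _) fun i _ _ => by positivity
      _ ≤ l ^ 2 * (C * √p) := by
        rw [← Finset.mul_sum]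
        gcongr
  have hLcard : p - (l ^ 2 * (C * √p) + m) ≤ (L.card : ℝ) := by
    have h1 : p ≤ L.card + (H ∪ G).card := by
      have := Finset.card_sdiff_add_card_inter (Finset.univ : Finset (Fin p)) (H ∪ G)
      rw [Finset.univ_inter, Finset.card_univ, Fintype.card_fin] at this
      exact this.ge
    have h2 := Finset.card_union_le H G
    have h3 : (p : ℝ) ≤ L.card + (H.card + G.card) := by exact_mod_cast h1.trans (by omega)
    linarith
  have hGL : Disjoint L G := by
    rw [hL, Finset.disjoint_left]
    intro i hi hiG
    simp only [Finset.mem_sdiff, Finset.mem_union, not_or] at hi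
    exact hi.2.2 hiG
  set F : (Option (Fin p) → ℝ) → ℝ := fun z =>
    ∑ i ∈ G, {z | K ≤ |dev (idio z) i|}.indicator (fun _ => Real.exp (l * |b i|)) z with hF
  have hmeas : ∀ i : Fin p, MeasurableSet {z : Option (Fin p) → ℝ | K ≤ |dev (idio z) i|} := by
    intro i
    refine measurableSet_le measurable_const (Measurable.abs ?_)
    exact (measurable_dev i).comp measurable_idio
  have hFi : ∀ i, Integrable (fun z => {z | K ≤ |dev (idio z) i|}.indicator
      (fun _ => Real.exp (l * |b i|)) z) P :=
    fun i => (integrable_const _).indicator (hmeas i)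
  have hE2 : P.real {z | W / 2 ≤ F z} ≤ 2 / K ^ 2 := by
    refine measureReal_le_of_integral (integrable_finsetSum _ fun i _ => hFi i)
      (fun z => Finset.sum_nonneg fun i _ =>
        Set.indicator_nonneg (fun _ _ => (Real.exp_pos _).le) z) (by positivity) ?_
    rw [integral_finsetSum _ fun i _ => hFi i]
    calc _ ≤ ∑ i ∈ G, 1 / K ^ 2 * Real.exp (l * |b i|) := by
          refine Finset.sum_le_sum fun i _ => ?_
          rw [integral_indicator (hmeas i), setIntegral_const, smul_eq_mul]
          gcongr
          exact measureReal_dev_le hp i hK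
      _ = 2 / K ^ 2 * (W / 2) := by rw [← Finset.mul_sum]; ring
  have hE1 := measureReal_sum_coshTerm_le hp hl hLprop hK
  have hsub : obs p γ θ ⁻¹' (coshRegion p γ l K)ᶜ ⊆
      {z | K * √p * Real.exp (l ^ 2) ≤ |∑ i ∈ L, coshTerm l b i z|} ∪ {z | W / 2 ≤ F z} := by
    intro z hz
    by_contra hcon
    simp only [Set.mem_union, Set.mem_ofPred_eq, not_or, not_le] at hcon
    obtain ⟨c1, c2⟩ := hcon
    refine hz ?_
    change _ < ∑ i, Real.cosh (l * (dev (obs p γ θ z) i / √(1 - γ)))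
    simp_rw [dev_obs_div hp hγ1]
    have d1 : ∑ i ∈ L, Real.cosh (l * (b i + dev (idio z) i))
        + ∑ i ∈ G, Real.cosh (l * (b i + dev (idio z) i))
        ≤ ∑ i, Real.cosh (l * (b i + dev (idio z) i)) := by
      rw [← Finset.sum_union hGL]
      exact Finset.sum_le_sum_of_subset_of_nonneg (Finset.subset_univ _)
        fun i _ _ => (Real.cosh_pos _).le
    have d2 : (L.card : ℝ) * Real.exp (halfVar p l) - K * √p * Real.exp (l ^ 2)
        < ∑ i ∈ L, Real.cosh (l * (b i + dev (idio z) i)) := by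
      have h1 : ∑ i ∈ L, coshTerm l b i z = ∑ i ∈ L, Real.cosh (l * (b i + dev (idio z) i))
          - ∑ i ∈ L, Real.exp (halfVar p l) * Real.cosh (l * b i) := by
        simp only [coshTerm, Finset.sum_sub_distrib]
      have h2 : (L.card : ℝ) * Real.exp (halfVar p l)
          ≤ ∑ i ∈ L, Real.exp (halfVar p l) * Real.cosh (l * b i) := by
        rw [← nsmul_eq_mul, ← Finset.sum_const]
        exact Finset.sum_le_sum fun i _ =>
          le_mul_of_one_le_right (Real.exp_pos _).le (Real.one_le_cosh _)
      have h3 := (abs_lt.1 c1).1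
      linarith
    have d3 : Real.exp (-(l * K)) / 4 * W
        ≤ ∑ i ∈ G, Real.cosh (l * (b i + dev (idio z) i)) := by
      calc Real.exp (-(l * K)) / 4 * W = Real.exp (-(l * K)) / 2 * (W - W / 2) := by ring
        _ ≤ Real.exp (-(l * K)) / 2 * (W - F z) := by gcongr
        _ = ∑ i ∈ G, Real.exp (-(l * K)) / 2 * (Real.exp (l * |b i|)
            - {z | K ≤ |dev (idio z) i|}.indicator (fun _ => Real.exp (l * |b i|)) z) := by
          rw [← Finset.mul_sum, Finset.sum_sub_distrib]
        _ ≤ _ := by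
          refine Finset.sum_le_sum fun i _ => ?_
          by_cases hi : K ≤ |dev (idio z) i|
          · rw [Set.indicator_of_mem (by exact hi), sub_self, mul_zero]
            exact (Real.cosh_pos _).le
          · rw [Set.indicator_of_notMem (by exact hi), sub_zero, div_mul_eq_mul_div,
              ← Real.exp_add]
            refine le_trans ?_ (half_exp_le_cosh _)
            gcongr
            rw [abs_mul, abs_of_nonneg hl0]
            have h1 : |b i| - K ≤ |b i + dev (idio z) i| := by
              have := abs_sub_abs_le_abs_sub (b i) (-dev (idio z) i)
              rw [sub_neg_eq_add, abs_neg] at this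
              linarith [not_le.1 hi]
            have h2 := mul_le_mul_of_nonneg_left h1 hl0
            linarith
    have d4 := mul_le_mul_of_nonneg_right hLcard (Real.exp_pos (halfVar p l)).le
    have d5 : (p - (l ^ 2 * (C * √p) + m)) * Real.exp (halfVar p l)
        = p * Real.exp (halfVar p l) - (l ^ 2 * (C * √p) + m) * Real.exp (halfVar p l) := by ring
    linarith
  calc _ ≤ _ := measureReal_mono hsub
    _ ≤ 2 * Real.cosh 2 / K ^ 2 + 2 / K ^ 2 :=
      (measureReal_union_le _ _).trans (add_le_add hE1 hE2)
    _ = _ := by ring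

end CoshTest

/-! ### The tuning of the hyperbolic cosine test -/

/-- The parameter `√(log (1 + p / m²))` of the test that looks for `m` signal coordinates. -/
noncomputable def tuning (p m : ℕ) : ℝ := √(Real.log (1 + (p : ℝ) / (m : ℝ) ^ 2))

theorem tuning_sq (p m : ℕ) : tuning p m ^ 2 = Real.log (1 + (p : ℝ) / (m : ℝ) ^ 2) :=
  Real.sq_sqrt (Real.log_nonneg (by
    have : 0 ≤ (p : ℝ) / (m : ℝ) ^ 2 := by positivity
    linarith))

theorem tuning_sq_le {p m : ℕ} (hm : 0 < m) : tuning p m ^ 2 ≤ p := by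
  have hm' : (1 : ℝ) ≤ m := by exact_mod_cast hm
  rw [tuning_sq]
  have h1 := Real.log_le_sub_one_of_pos (x := 1 + (p : ℝ) / (m : ℝ) ^ 2) (by positivity)
  have h2 : (p : ℝ) / (m : ℝ) ^ 2 ≤ p := div_le_self (by positivity) (one_le_pow₀ hm')
  linarith

theorem half_le_tuning_sq {p m : ℕ} (hm : 0 < m) (hmp : m ^ 2 ≤ p) : 1 / 2 ≤ tuning p m ^ 2 := by
  have hm' : (1 : ℝ) ≤ m := by exact_mod_cast hm
  rw [tuning_sq]
  have h3 : 1 ≤ (p : ℝ) / (m : ℝ) ^ 2 := by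
    rw [one_le_div (by positivity)]
    exact_mod_cast hmp
  have h4 : Real.log 2 ≤ Real.log (1 + (p : ℝ) / (m : ℝ) ^ 2) :=
    Real.log_le_log (by norm_num) (by linarith)
  linarith [Real.log_two_gt_d9]

/-- A total weight `m * exp (a * l²)` of the signal coordinates is sufficient for the
test if `a` is large enough. -/
theorem exists_weight_bound (K C : ℝ) (hK : 0 < K) (hC : 0 ≤ C) :
    ∃ a : ℝ, 4 ≤ a ∧ ∀ p m : ℕ, 0 < m → m ^ 2 ≤ p →
      2 * (K * √p * Real.exp (tuning p m ^ 2))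
        + (tuning p m ^ 2 * (C * √p) + m) * Real.exp (halfVar p (tuning p m))
      ≤ Real.exp (-(tuning p m * K)) / 4 * (m * Real.exp (a * tuning p m ^ 2)) := by
  set M := Real.log (4 * (2 * K + C + 1)) with hM
  have hM0 : 0 ≤ M := Real.log_nonneg (by linarith)
  refine ⟨4 + 2 * K + 2 * M, by linarith, fun p m hm hmp => ?_⟩
  have hm' : (0 : ℝ) < m := by exact_mod_cast hm
  set l := tuning p m with hl
  have hl0 : 0 ≤ l := Real.sqrt_nonneg _
  have hl2 : 1 / 2 ≤ l ^ 2 := half_le_tuning_sq hm hmp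
  have hll : l ≤ 2 * l ^ 2 := by
    have : 1 / 2 ≤ l := by
      by_contra hcon
      nlinarith [not_le.1 hcon]
    nlinarith
  have hE : Real.exp (l ^ 2) = 1 + (p : ℝ) / (m : ℝ) ^ 2 := by
    rw [hl, tuning_sq, Real.exp_log (by positivity)]
  set E := Real.exp (l ^ 2) with hEdef
  have hE1 : 1 ≤ E := Real.one_le_exp (by positivity)
  have hlE : l ^ 2 ≤ E := by linarith [Real.add_one_le_exp (l ^ 2)]
  have hq : Real.exp (halfVar p l) ≤ E :=
    Real.exp_le_exp.2 ((halfVar_le l).trans (by linarith))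
  have hmw : (m : ℝ) ≤ √p := by
    rw [← Real.sqrt_sq hm'.le]
    exact Real.sqrt_le_sqrt (by exact_mod_cast hmp)
  have hw : √(p : ℝ) ≤ m * Real.exp (l ^ 2 / 2) := by
    rw [← Real.sqrt_sq (by positivity : 0 ≤ m * Real.exp (l ^ 2 / 2))]
    refine Real.sqrt_le_sqrt ?_
    rw [mul_pow, ← Real.exp_nat_mul]
    have : ((2 : ℕ) : ℝ) * (l ^ 2 / 2) = l ^ 2 := by push_cast; ring
    rw [this, ← hEdef, hE]
    have : (m : ℝ) ^ 2 * (1 + (p : ℝ) / (m : ℝ) ^ 2) = m ^ 2 + p := by field_simp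
    rw [this]
    linarith [sq_nonneg (m : ℝ)]
  calc 2 * (K * √p * E) + (l ^ 2 * (C * √p) + m) * Real.exp (halfVar p l)
      ≤ 2 * (K * √p * (E * E)) + (E * (C * √p) + E * √p) * E := by
        have hmE : (m : ℝ) ≤ E * √p := hmw.trans (le_mul_of_one_le_left (Real.sqrt_nonneg _) hE1)
        gcongr
        exact le_mul_of_one_le_left (by positivity) hE1
    _ = (2 * K + C + 1) * (E * E) * √p := by ring
    _ ≤ (2 * K + C + 1) * (E * E) * (m * Real.exp (l ^ 2 / 2)) := by gcongr
    _ = m / 4 * (Real.exp M * (E * E * Real.exp (l ^ 2 / 2))) := by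
        rw [hM, Real.exp_log (by positivity)]
        ring
    _ = m / 4 * Real.exp (M + 5 / 2 * l ^ 2) := by
        rw [hEdef, ← Real.exp_add, ← Real.exp_add, ← Real.exp_add]
        ring_nf
    _ ≤ m / 4 * Real.exp (-(l * K) + (4 + 2 * K + 2 * M) * l ^ 2) := by
        refine mul_le_mul_of_nonneg_left (Real.exp_le_exp.2 ?_) (by positivity)
        have h1 := mul_le_mul_of_nonneg_right hll hK.le
        have h2 := mul_le_mul_of_nonneg_left hl2 hM0
        nlinarith
    _ = _ := by
        rw [Real.exp_add]
        ring

/-! ### The upper bound at the rate -/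

section Upper

variable {p s : ℕ} {γ ε η : ℝ}

theorem risk_le_of_two_tests (hγ : γ ∈ Set.Icc (0 : ℝ) 1)
    {R₁ R₂ : Set (EuclideanSpace ℝ (Fin p))} (h₁ : MeasurableSet R₁) (h₂ : MeasurableSet R₂)
    (hη : 0 ≤ η)
    (n₁ : (gaussianVector (Option (Fin p))).real (obs p γ 0 ⁻¹' R₁) ≤ η / 4)
    (n₂ : (gaussianVector (Option (Fin p))).real (obs p γ 0 ⁻¹' R₂) ≤ η / 4)
    (h : ∀ θ ∈ alternative p s ε,
      (gaussianVector (Option (Fin p))).real (obs p γ θ ⁻¹' R₁ᶜ) ≤ η / 4 ∨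
        (gaussianVector (Option (Fin p))).real (obs p γ θ ⁻¹' R₂ᶜ) ≤ η / 4) :
    risk p s γ ε ≤ ENNReal.ofReal η := by
  refine risk_le_of_test hγ (h₁.union h₂) hη ?_ fun θ hθ => ?_
  · rw [Set.preimage_union]
    exact (measureReal_union_le _ _).trans (by linarith)
  · rcases h θ hθ with h | h
    · exact (measureReal_mono (Set.preimage_mono
        (Set.compl_subset_compl.2 Set.subset_union_left))).trans (by linarith)
    · exact (measureReal_mono (Set.preimage_mono
        (Set.compl_subset_compl.2 Set.subset_union_right))).trans (by linarith)

theorem sq_le_sum_sq (hε : 0 ≤ ε) {θ : EuclideanSpace ℝ (Fin p)} (hθ : θ ∈ alternative p s ε) :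
    ε ^ 2 ≤ ∑ i, θ i ^ 2 := by
  rw [← EuclideanSpace.real_norm_sq_eq]
  exact pow_le_pow_left₀ hε hθ.1 2

theorem card_support_le {θ : EuclideanSpace ℝ (Fin p)} (hθ : θ ∈ alternative p s ε) :
    (Finset.univ.filter fun i => θ i ≠ 0).card ≤ s := by
  have := hθ.2
  rwa [Set.ncard_eq_toFinset_card', Set.toFinset_ofPred] at this

theorem sq_sum_le {θ : EuclideanSpace ℝ (Fin p)} (hθ : θ ∈ alternative p s ε) :
    (∑ i, θ i) ^ 2 ≤ s * ∑ i, θ i ^ 2 := by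
  have h1 : ∑ i, θ i = ∑ i ∈ Finset.univ.filter fun i => θ i ≠ 0, θ i :=
    (Finset.sum_filter_ne_zero _).symm
  have h2 := sq_sum_le_card_mul_sum_sq (s := Finset.univ.filter fun i => θ i ≠ 0)
    (f := fun i => θ i)
  rw [h1]
  refine h2.trans ?_
  have h3 : ((Finset.univ.filter fun i => θ i ≠ 0).card : ℝ) ≤ s := by
    exact_mod_cast card_support_le hθ
  gcongr
  exact Finset.subset_univ _

/-- Projecting out the mean keeps at least the fraction `1 - s / p` of the energy of an `s`-sparse
vector. -/
theorem le_sum_dev_sq (hp : 0 < p) {θ : EuclideanSpace ℝ (Fin p)} (hθ : θ ∈ alternative p s ε) :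
    (1 - s / p) * ∑ i, θ i ^ 2 ≤ ∑ i, dev θ i ^ 2 := by
  have hp' : (0 : ℝ) < p := by exact_mod_cast hp
  rw [sum_dev_sq hp]
  have h1 : (∑ i, θ i) ^ 2 / p ≤ s / p * ∑ i, θ i ^ 2 := by
    rw [div_mul_eq_mul_div]
    gcongr
    exact sq_sum_le hθ
  linarith

/-- An exponential dominates a quadratic: the inequality turns an energy condition on the signal
into a lower bound on its exponential weight. -/
theorem exp_mul_sub_one_le {y y₀ : ℝ} (hy : 0 ≤ y) (hy₀ : 2 ≤ y₀) :
    Real.exp y₀ * (y ^ 2 / y₀ ^ 2 - 1) ≤ Real.exp y := by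
  have h0 : 0 < y₀ := by linarith
  rcases le_or_gt y y₀ with h | h
  · have : y ^ 2 / y₀ ^ 2 ≤ 1 := by
      rw [div_le_one (by positivity)]
      gcongr
    have h1 : Real.exp y₀ * (y ^ 2 / y₀ ^ 2 - 1) ≤ 0 :=
      mul_nonpos_of_nonneg_of_nonpos (Real.exp_pos _).le (by linarith)
    exact h1.trans (Real.exp_pos _).le
  · obtain ⟨d, hd, rfl⟩ : ∃ d, 0 < d ∧ y = y₀ + d := ⟨y - y₀, by linarith, by ring⟩
    rw [Real.exp_add]
    gcongr
    have h1 := Real.quadratic_le_exp_of_nonneg hd.le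
    have h2 : (y₀ + d) ^ 2 / y₀ ^ 2 = (1 + d / y₀) ^ 2 := by field_simp
    have h3 : d / y₀ ≤ d / 2 := by gcongr
    have h4 : 0 ≤ d / y₀ := by positivity
    rw [h2]
    nlinarith

/-- The numerical requirements on the threshold `K`: all error probabilities of the three tests
are at most `η / 4`. -/
structure Calibrated (η K : ℝ) : Prop where
  one_le : 1 ≤ K
  mean : 1 / K ^ 2 ≤ η / 4
  chi : (varSq + 2) / K ^ 2 ≤ η / 4
  cosh : (2 * Real.cosh 2 + 2) / K ^ 2 ≤ η / 4

theorem varSq_nonneg : 0 ≤ varSq := variance_nonneg _ _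

theorem exists_calibrated (hη : η ∈ Set.Ioo (0 : ℝ) 1) : ∃ K, Calibrated η K := by
  have hv := varSq_nonneg
  have hc := Real.one_le_cosh 2
  have hη0 := hη.1
  set M := varSq + 2 * Real.cosh 2 + 2 with hM
  have hM1 : 1 ≤ M := by linarith
  have hsq : √(4 * M / η) ^ 2 = 4 * M / η := Real.sq_sqrt (by positivity)
  have hle : ∀ x, x ≤ M → x / √(4 * M / η) ^ 2 ≤ η / 4 := by
    intro x hx
    rw [hsq]
    calc x / (4 * M / η) ≤ M / (4 * M / η) := by gcongr
      _ = η / 4 := by field_simp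
  refine ⟨√(4 * M / η), Real.one_le_sqrt.2 ?_, hle _ hM1, hle _ (by linarith), hle _ (by linarith)⟩
  rw [one_le_div hη0]
  linarith [hη.2]

theorem Calibrated.chi_null {K : ℝ} (h : Calibrated η K) (hγ : γ ∈ Set.Icc (0 : ℝ) 1)
    (hp : 0 < p) :
    (gaussianVector (Option (Fin p))).real (obs p γ 0 ⁻¹' chiRegion p γ K) ≤ η / 4 := by
  have hK := h.one_le
  refine (chiRegion_null hγ hp (by linarith)).trans (le_trans ?_ h.chi)
  gcongr
  linarith

theorem Calibrated.chi_alt {K : ℝ} (h : Calibrated η K) (hγ : γ ∈ Set.Icc (0 : ℝ) 1)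
    (hp : 0 < p) {θ : EuclideanSpace ℝ (Fin p)}
    (hθ : 16 * K ^ 2 * ((1 - γ) * √p) < ∑ i, dev θ i ^ 2) :
    (gaussianVector (Option (Fin p))).real (obs p γ θ ⁻¹' (chiRegion p γ K)ᶜ) ≤ η / 4 :=
  (chiRegion_alt hγ hp h.one_le hθ).trans h.chi

/-- The chi-square test alone. -/
theorem risk_le_chi {K : ℝ} (hK : Calibrated η K) (hη : 0 ≤ η) (hγ : γ ∈ Set.Icc (0 : ℝ) 1)
    (hp : 0 < p) (hsp : s ≤ p) (hε0 : 0 ≤ ε)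
    (hε : 16 * K ^ 2 * ((1 - γ) * √p) < (1 - s / p) * ε ^ 2) :
    risk p s γ ε ≤ ENNReal.ofReal η := by
  refine risk_le_of_two_tests hγ (measurableSet_chiRegion K) (measurableSet_chiRegion K) hη
    (hK.chi_null hγ hp) (hK.chi_null hγ hp) fun θ hθ => Or.inl (hK.chi_alt hγ hp ?_)
  have hp' : (0 : ℝ) < p := by exact_mod_cast hp
  have h1 : 0 ≤ 1 - (s : ℝ) / p := by
    rw [sub_nonneg, div_le_one hp']
    exact_mod_cast hsp
  calc _ < (1 - s / p) * ε ^ 2 := hε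
    _ ≤ (1 - s / p) * ∑ i, θ i ^ 2 := by gcongr; exact sq_le_sum_sq hε0 hθ
    _ ≤ _ := le_sum_dev_sq hp hθ

/-- The chi-square test combined with the test based on the sample mean. -/
theorem risk_le_chi_mean {K : ℝ} (hK : Calibrated η K) (hη : 0 ≤ η) (hγ : γ ∈ Set.Icc (0 : ℝ) 1)
    (hp : 0 < p) (hε0 : 0 ≤ ε)
    (hε : 16 * K ^ 2 * ((1 - γ) * √p) + 4 * K ^ 2 * (1 - γ + γ * p) < ε ^ 2) :
    risk p s γ ε ≤ ENNReal.ofReal η := by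
  have hK0 : 0 < K := by linarith [hK.one_le]
  refine risk_le_of_two_tests hγ (measurableSet_chiRegion K) (measurableSet_meanRegion K) hη
    (hK.chi_null hγ hp) ((meanRegion_null hγ hp hK0).trans hK.mean) fun θ hθ => ?_
  have h1 := sq_le_sum_sq hε0 hθ
  have h2 := sum_dev_sq hp θ
  rcases lt_or_ge (16 * K ^ 2 * ((1 - γ) * √p)) (∑ i, dev θ i ^ 2) with h | h
  · exact Or.inl (hK.chi_alt hγ hp h)
  · exact Or.inr ((meanRegion_alt hγ hp hK0 (by linarith)).trans hK.mean)

/-- The chi-square test combined with the hyperbolic cosine test: when the projected signal has too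
little energy for the former, some `m` coordinates must carry enough weight for the latter. -/
theorem risk_le_chi_cosh {K a : ℝ} (hK : Calibrated η K) (hη : 0 ≤ η)
    (hγ : γ ∈ Set.Icc (0 : ℝ) 1) (hγ1 : γ < 1) {m : ℕ} (hm : 0 < m) (hmp : m ^ 2 ≤ p)
    (ha : 2 * (K * √p * Real.exp (tuning p m ^ 2))
        + (tuning p m ^ 2 * (16 * K ^ 2 * √p) + m) * Real.exp (halfVar p (tuning p m))
      ≤ Real.exp (-(tuning p m * K)) / 4 * (m * Real.exp (a * tuning p m ^ 2)))
    (h : ∀ θ ∈ alternative p s ε, ∑ i, dev θ i ^ 2 ≤ 16 * K ^ 2 * ((1 - γ) * √p) →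
      ∃ G : Finset (Fin p), G.card ≤ m ∧ m * Real.exp (a * tuning p m ^ 2)
        ≤ ∑ i ∈ G, Real.exp (tuning p m * |dev θ i / √(1 - γ)|)) :
    risk p s γ ε ≤ ENNReal.ofReal η := by
  have hK0 : 0 < K := by linarith [hK.one_le]
  have hp : 0 < p := lt_of_lt_of_le (by positivity) hmp
  have hσ : 0 < 1 - γ := by linarith
  have hl := tuning_sq_le (p := p) hm
  refine risk_le_of_two_tests hγ (measurableSet_chiRegion K)
    (measurableSet_coshRegion (tuning p m) K) hη (hK.chi_null hγ hp)
    ((coshRegion_null hp hγ1 hl hK0).trans (le_trans (by gcongr; linarith) hK.cosh)) fun θ hθ => ?_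
  rcases lt_or_ge (16 * K ^ 2 * ((1 - γ) * √p)) (∑ i, dev θ i ^ 2) with hQ | hQ
  · exact Or.inl (hK.chi_alt hγ hp hQ)
  · obtain ⟨G, hG, hW⟩ := h θ hθ hQ
    refine Or.inr ((coshRegion_alt (l := tuning p m) (C := 16 * K ^ 2) (m := m) hp hγ1
      (Real.sqrt_nonneg _) hl hK0 ?_ (G := G) (by exact_mod_cast hG) (ha.trans (by gcongr))).trans hK.cosh)
    simp_rw [div_pow, Real.sq_sqrt hσ.le]
    rw [← Finset.sum_div, div_le_iff₀ hσ]
    linarith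

/-- In the sparse regime the support carries the weight. -/
theorem exists_weight_sparse (hγ1 : γ < 1) {a : ℝ} (ha : 4 ≤ a) (hs : 0 < s) (hsp : s ^ 2 ≤ p)
    (hs4 : 4 * s ≤ p) (hε0 : 0 ≤ ε) (hε : 4 * a ^ 2 * ((1 - γ) * s * tuning p s ^ 2) ≤ ε ^ 2)
    {θ : EuclideanSpace ℝ (Fin p)} (hθ : θ ∈ alternative p s ε) :
    ∃ G : Finset (Fin p), G.card ≤ s ∧ s * Real.exp (a * tuning p s ^ 2)
      ≤ ∑ i ∈ G, Real.exp (tuning p s * |dev θ i / √(1 - γ)|) := by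
  have hp : 0 < p := by omega
  have hp' : (0 : ℝ) < p := by exact_mod_cast hp
  have hσ : 0 < 1 - γ := by linarith
  have hs4' : 4 * (s : ℝ) ≤ p := by exact_mod_cast hs4
  set l := tuning p s with hl
  have hl0 : 0 ≤ l := Real.sqrt_nonneg _
  have hl2 : 1 / 2 ≤ l ^ 2 := half_le_tuning_sq hs hsp
  set S := Finset.univ.filter fun i => θ i ≠ 0 with hS
  have hScard : (S.card : ℝ) ≤ s := Nat.cast_le.2 (card_support_le hθ)
  have hN := sq_le_sum_sq hε0 hθ
  have hsum : ∑ i ∈ S, θ i = ∑ i, θ i := Finset.sum_filter_ne_zero _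
  have hsumsq : ∑ i ∈ S, θ i ^ 2 = ∑ i, θ i ^ 2 := by
    refine Finset.sum_subset (Finset.subset_univ _) fun i _ hi => ?_
    simp only [hS, Finset.mem_filter, Finset.mem_univ, true_and, not_not] at hi
    rw [hi]
    ring
  have henergy : (∑ i, θ i ^ 2) / 2 ≤ ∑ i ∈ S, dev θ i ^ 2 := by
    have h1 : ∀ i, θ i ^ 2 - 2 * ((∑ j, θ j) / p) * θ i ≤ dev θ i ^ 2 := by
      intro i
      rw [dev]
      nlinarith [sq_nonneg ((∑ j, θ j) / p)]
    have h2 := Finset.sum_le_sum fun i (_ : i ∈ S) => h1 i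
    rw [Finset.sum_sub_distrib, ← Finset.mul_sum, hsum, hsumsq] at h2
    have h3 : 2 * ((∑ j, θ j) / p) * ∑ i, θ i = 2 * ((∑ j, θ j) ^ 2 / p) := by ring
    have h4 : (∑ j, θ j) ^ 2 / p ≤ (∑ i, θ i ^ 2) / 4 := by
      rw [div_le_iff₀ hp']
      have h5 : 0 ≤ ∑ i, θ i ^ 2 := Finset.sum_nonneg fun i _ => sq_nonneg _
      nlinarith [sq_sum_le hθ]
    linarith
  refine ⟨S, card_support_le hθ, ?_⟩
  have hy₀ : 2 ≤ a * l ^ 2 := by nlinarith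
  have hy : ∑ i ∈ S, (l * |dev θ i / √(1 - γ)|) ^ 2 / (a * l ^ 2) ^ 2 ≥ 2 * s := by
    have h1 : ∀ i, (l * |dev θ i / √(1 - γ)|) ^ 2 / (a * l ^ 2) ^ 2
        = dev θ i ^ 2 / ((1 - γ) * (a ^ 2 * l ^ 2)) := by
      intro i
      have hl0' : 0 < l ^ 2 := by linarith
      rw [mul_pow, sq_abs, div_pow, Real.sq_sqrt hσ.le]
      field_simp
    simp_rw [h1]
    rw [← Finset.sum_div, ge_iff_le, le_div_iff₀ (by positivity)]
    linarith
  calc s * Real.exp (a * l ^ 2) ≤ Real.exp (a * l ^ 2) *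
        (∑ i ∈ S, (l * |dev θ i / √(1 - γ)|) ^ 2 / (a * l ^ 2) ^ 2 - S.card) := by
        rw [mul_comm]
        gcongr
        linarith
    _ = ∑ i ∈ S, Real.exp (a * l ^ 2) *
        ((l * |dev θ i / √(1 - γ)|) ^ 2 / (a * l ^ 2) ^ 2 - 1) := by
        rw [← Finset.mul_sum, Finset.sum_sub_distrib]
        simp
    _ ≤ _ := Finset.sum_le_sum fun i _ => exp_mul_sub_one_le (by positivity) hy₀

/-- In the dense regime the zero coordinates carry the weight: after projection they equal minus the
mean of the signal, which is large because the projected signal has little energy. -/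
theorem exists_weight_dense (hγ1 : γ < 1) {a : ℝ} {m : ℕ} (hm : 0 < m)
    (hsm : s + m = p) {Q : ℝ} (hε0 : 0 ≤ ε)
    (hε : Q + a ^ 2 * ((1 - γ) * p * tuning p m ^ 2) ≤ ε ^ 2)
    {θ : EuclideanSpace ℝ (Fin p)} (hθ : θ ∈ alternative p s ε) (hQ : ∑ i, dev θ i ^ 2 ≤ Q) :
    ∃ G : Finset (Fin p), G.card ≤ m ∧ m * Real.exp (a * tuning p m ^ 2)
      ≤ ∑ i ∈ G, Real.exp (tuning p m * |dev θ i / √(1 - γ)|) := by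
  have hp : 0 < p := by omega
  have hp' : (0 : ℝ) < p := by exact_mod_cast hp
  have hσ : 0 < 1 - γ := by linarith
  set l := tuning p m with hl
  have hl0 : 0 ≤ l := Real.sqrt_nonneg _
  have hN := sq_le_sum_sq hε0 hθ
  rw [sum_dev_sq hp] at hQ
  have hmean : a * l * √(1 - γ) ≤ |(∑ i, θ i) / p| := by
    refine (abs_le_of_sq_le_sq' ?_ (abs_nonneg _)).2
    rw [sq_abs, mul_pow, mul_pow, Real.sq_sqrt hσ.le, div_pow, le_div_iff₀ (by positivity)]
    have h1 : a ^ 2 * ((1 - γ) * p * l ^ 2) ≤ (∑ i, θ i) ^ 2 / p := by linarith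
    rw [le_div_iff₀ hp'] at h1
    linarith
  have hcard : m ≤ (Finset.univ.filter fun i => θ i = 0).card := by
    have h1 := Finset.card_filter_add_card_filter_not (s := (Finset.univ : Finset (Fin p)))
      fun i => θ i = 0
    rw [Finset.card_univ, Fintype.card_fin] at h1
    have h2 := card_support_le hθ
    simp only [ne_eq] at h2
    omega
  obtain ⟨G, hGsub, hGcard⟩ := Finset.exists_subset_card_eq hcard
  refine ⟨G, hGcard.le, ?_⟩
  rw [← hGcard, ← nsmul_eq_mul, ← Finset.sum_const]
  refine Finset.sum_le_sum fun i hi => Real.exp_le_exp.2 ?_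
  have hi0 : θ i = 0 := (Finset.mem_filter.1 (hGsub hi)).2
  have h1 : a * l ≤ |dev θ i / √(1 - γ)| := by
    rw [dev, hi0, zero_sub, abs_div, abs_neg, abs_of_pos (Real.sqrt_pos.2 hσ),
      le_div_iff₀ (Real.sqrt_pos.2 hσ)]
    exact hmean
  calc a * l ^ 2 = l * (a * l) := by ring
    _ ≤ _ := by gcongr

theorem rate_upper_bound (hη : η ∈ Set.Ioo (0 : ℝ) 1) :
    ∃ C : ℝ, 0 < C ∧ ∀ (p s : ℕ) (γ : ℝ), 1 ≤ s → s ≤ p → γ ∈ Set.Icc (0 : ℝ) 1 →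
      ∀ ε : ℝ, 0 < ε → C * √(rateSq p s γ) < ε → risk p s γ ε ≤ ENNReal.ofReal η := by
  obtain ⟨K, hK⟩ := exists_calibrated hη
  have hK1 := hK.one_le
  obtain ⟨a, ha4, ha⟩ := exists_weight_bound K (16 * K ^ 2) (by linarith) (by positivity)
  set T := 16 * K ^ 2 + a with hT
  have hT1 : 1 ≤ T := by nlinarith
  have hTK : 16 * K ^ 2 ≤ T := by linarith
  have hTa : a ≤ T := by nlinarith
  -- The cases below need `(8 * T) ^ 2` to be at least `4 * a ^ 2` and `16 * (16 * K ^ 2)`.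
  refine ⟨8 * T, by linarith, fun p s γ hs hsp hγ ε hε hlt => ?_⟩
  have hp : 0 < p := by omega
  have hp' : (1 : ℝ) ≤ p := by exact_mod_cast hp
  have hs' : (1 : ℝ) ≤ s := by exact_mod_cast hs
  have hσ : 0 ≤ 1 - γ := by linarith [hγ.2]
  have hV : 0 < 1 - γ + γ * p := variance_pos hγ hp
  have hη0 := hη.1.le
  have hsq : 64 * T ^ 2 * rateSq p s γ < ε ^ 2 := by
    rcases le_or_gt (rateSq p s γ) 0 with h | h
    · have : 64 * T ^ 2 * rateSq p s γ ≤ 0 := mul_nonpos_of_nonneg_of_nonpos (by positivity) h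
      exact this.trans_lt (by positivity)
    · have h1 : (8 * T * √(rateSq p s γ)) ^ 2 < ε ^ 2 := by gcongr
      rw [mul_pow, Real.sq_sqrt h.le] at h1
      linarith
  have hTT : 64 * T ≤ 64 * T ^ 2 := by nlinarith
  -- Degenerate noise: the projected observation is noiseless.
  have hdegenerate : γ = 1 → s < p → risk p s γ ε ≤ ENNReal.ofReal η := by
    intro h1 h2
    refine risk_le_chi hK hη0 hγ hp hsp hε.le ?_
    rw [h1, sub_self, zero_mul, mul_zero]
    have : (s : ℝ) / p < 1 := by
      rw [div_lt_one (by linarith)]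
      exact_mod_cast h2
    have : 0 < 1 - (s : ℝ) / p := by linarith
    positivity
  have hmean : rateSq p s γ = (1 - γ) * √p + (1 - γ + γ * p) →
      risk p s γ ε ≤ ENNReal.ofReal η := by
    intro h
    refine risk_le_chi_mean hK hη0 hγ hp hε.le (lt_of_le_of_lt ?_ hsq)
    rw [h, mul_add (64 * T ^ 2)]
    have h1 : 16 * K ^ 2 ≤ 64 * T ^ 2 := by linarith
    have h2 : 4 * K ^ 2 ≤ 64 * T ^ 2 := by nlinarith
    exact add_le_add (mul_le_mul_of_nonneg_right h1 (by positivity : 0 ≤ (1 - γ) * √(p : ℝ)))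
      (mul_le_mul_of_nonneg_right h2 hV.le)
  unfold rateSq at hsq hmean
  split_ifs at hsq hmean with h1 h2 h3
  · have hssq : s ^ 2 < p := by
      have := pow_lt_pow_left₀ h1 (by linarith) two_ne_zero
      rw [Real.sq_sqrt (by linarith)] at this
      exact_mod_cast this
    have h2s : 2 * s ≤ p := by nlinarith [sq_nonneg ((s : ℤ) - 1)]
    rcases hγ.2.eq_or_lt with hγ1 | hγ1
    · exact hdegenerate hγ1 (by omega)
    have hσ' : 0 < 1 - γ := by linarith
    -- For `p ≥ 16` the support has at most `p / 4` elements. For smaller `p` the sparse rate is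
    -- comparable to `σ² √p`.
    rcases lt_or_ge p 16 with hp16 | hp16
    · refine risk_le_chi hK hη0 hγ hp hsp hε.le ?_
      have e1 : 1 / 2 ≤ 1 - (s : ℝ) / p := by
        have h2s' : 2 * (s : ℝ) ≤ p := by exact_mod_cast h2s
        have : (s : ℝ) / p ≤ 1 / 2 := by
          rw [div_le_iff₀ (by linarith)]
          linarith
        linarith
      have e2 : 1 / 2 ≤ Real.log (1 + (p : ℝ) / (s : ℝ) ^ 2) := by
        rw [← tuning_sq]
        exact half_le_tuning_sq hs hssq.le
      have e3 : √(p : ℝ) ≤ 4 := by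
        rw [Real.sqrt_le_left (by norm_num)]
        have : (p : ℝ) < 16 := by exact_mod_cast hp16
        linarith
      calc 16 * K ^ 2 * ((1 - γ) * √p) ≤ T * ((1 - γ) * 4) := by gcongr
        _ ≤ 1 / 2 * (64 * T * ((1 - γ) * 1 * (1 / 2))) := by nlinarith
        _ ≤ 1 / 2 * (64 * T ^ 2 * ((1 - γ) * s * Real.log (1 + (p : ℝ) / (s : ℝ) ^ 2))) := by
          gcongr
        _ < 1 / 2 * ε ^ 2 := by gcongr
        _ ≤ _ := by gcongr
    · refine risk_le_chi_cosh hK hη0 hγ hγ1 hs hssq.le (ha p s hs hssq.le) fun θ hθ _ =>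
        exists_weight_sparse hγ1 ha4 hs hssq.le (by nlinarith) hε.le ?_ hθ
      rw [tuning_sq]
      refine le_trans ?_ hsq.le
      have hlog : 0 ≤ Real.log (1 + (p : ℝ) / (s : ℝ) ^ 2) := by
        rw [← tuning_sq]
        positivity
      gcongr
      nlinarith
  · have hm0 : 0 < (p : ℝ) - s := by
      have : 0 < √(p : ℝ) := Real.sqrt_pos.2 (by linarith)
      linarith
    have hA : 0 ≤ (1 - γ) * √(p : ℝ) := by positivity
    rcases le_total ((1 - γ) * (p : ℝ) ^ (3 / 2 : ℝ) / ((p : ℝ) - s)) (1 - γ + γ * p) with hB | hB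
    · rw [min_eq_left hB] at hsq
      rw [rpow_three_halves (by linarith)] at hsq
      refine risk_le_chi hK hη0 hγ hp hsp hε.le ?_
      have e1 : 0 < 1 - (s : ℝ) / p := by
        rw [sub_pos, div_lt_one (by linarith)]
        linarith
      calc 16 * K ^ 2 * ((1 - γ) * √p) ≤ 64 * T ^ 2 * ((1 - γ) * √p) :=
          mul_le_mul_of_nonneg_right (by linarith) hA
        _ = (1 - (s : ℝ) / p) * (64 * T ^ 2 * ((1 - γ) * (p * √p) / ((p : ℝ) - s))) := by
          field_simp
        _ ≤ (1 - (s : ℝ) / p)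
            * (64 * T ^ 2 * ((1 - γ) * √p + (1 - γ) * (p * √p) / ((p : ℝ) - s))) := by
          gcongr
          linarith
        _ < _ := by gcongr
    · exact hmean (by rw [min_eq_right hB])
  · rcases hγ.2.eq_or_lt with hγ1 | hγ1
    · exact hdegenerate hγ1 h3
    rcases le_total ((1 - γ) * p * Real.log (1 + (p : ℝ) / ((p : ℝ) - s) ^ 2)) (1 - γ + γ * p)
      with hB | hB
    · rw [min_eq_left hB] at hsq
      have hcast : ((p - s : ℕ) : ℝ) = (p : ℝ) - s := by push_cast [hsp]; ring
      have hmsq : (p - s) ^ 2 ≤ p := by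
        have h4 : ((p - s : ℕ) : ℝ) ^ 2 ≤ √(p : ℝ) ^ 2 := by
          gcongr
          rw [hcast]
          linarith [not_le.1 h2]
        rw [Real.sq_sqrt (by linarith)] at h4
        exact_mod_cast h4
      have hm : 0 < p - s := by omega
      refine risk_le_chi_cosh hK hη0 hγ hγ1 hm hmsq (ha p (p - s) hm hmsq) fun θ hθ hQ =>
        exists_weight_dense hγ1 hm (by omega) hε.le ?_ hθ hQ
      rw [tuning_sq, hcast]
      refine le_trans ?_ hsq.le
      have hlog : 0 ≤ Real.log (1 + (p : ℝ) / ((p : ℝ) - s) ^ 2) := by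
        rw [← hcast, ← tuning_sq]
        positivity
      have h5 : 16 * K ^ 2 ≤ 64 * T ^ 2 := by linarith
      have h6 : a ^ 2 ≤ 64 * T ^ 2 := by nlinarith
      rw [mul_add]
      gcongr
    · exact hmean (by rw [min_eq_right hB])
  · exact hmean rfl

/-- The squared rate is nonnegative, so that its square root loses no information. -/
theorem rateSq_nonneg (hs : 1 ≤ s) (hsp : s ≤ p) (hγ : γ ∈ Set.Icc (0 : ℝ) 1) :
    0 ≤ rateSq p s γ := by
  have hσ : 0 ≤ 1 - γ := by linarith [hγ.2]
  have hV : 0 < 1 - γ + γ * p := variance_pos hγ (by omega)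
  have hm : 0 ≤ (p : ℝ) - s := by
    rw [sub_nonneg]
    exact_mod_cast hsp
  have hlog : ∀ x : ℝ, 0 ≤ Real.log (1 + (p : ℝ) / x ^ 2) := fun x => Real.log_nonneg (by
    have : 0 ≤ (p : ℝ) / x ^ 2 := by positivity
    linarith)
  unfold rateSq
  split_ifs
  · have := hlog s
    positivity
  · exact add_nonneg (by positivity) (le_min (by positivity) hV.le)
  · have := hlog ((p : ℝ) - s)
    exact add_nonneg (by positivity) (le_min (by positivity) hV.le)
  · positivity

end Upper

end SparseDetection

/-- The function `√rateSq` is a minimax separation rate, and every minimax separation rate `εs`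
satisfies `εs² ≍ rateSq` with universal constants, over all `1 ≤ s ≤ p` and `γ ∈ [0, 1]`. -/
theorem mainTheorem1 :
    SparseDetection.IsMinimaxSeparationRate
        (fun p s γ => Real.sqrt (SparseDetection.rateSq p s γ)) ∧
      ∀ εs : ℕ → ℕ → ℝ → ℝ, SparseDetection.IsMinimaxSeparationRate εs →
        ∃ a b : ℝ, 0 < a ∧ 0 < b ∧
          ∀ (p s : ℕ) (γ : ℝ), 1 ≤ s → s ≤ p → γ ∈ Set.Icc (0 : ℝ) 1 →
            a * SparseDetection.rateSq p s γ ≤ εs p s γ ^ 2 ∧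
              εs p s γ ^ 2 ≤ b * SparseDetection.rateSq p s γ := by
  have hrate : SparseDetection.IsMinimaxSeparationRate
      (fun p s γ => Real.sqrt (SparseDetection.rateSq p s γ)) :=
    ⟨fun _ _ _ _ _ _ => Real.sqrt_nonneg _, fun η hη => SparseDetection.rate_upper_bound hη,
      fun η hη => SparseDetection.rate_lower_bound hη.1⟩
  refine ⟨hrate, fun εs hεs => ?_⟩
  obtain ⟨K, hK, h1⟩ := hεs.le_const_mul hrate
  obtain ⟨K', hK', h2⟩ := hrate.le_const_mul hεs
  refine ⟨1 / K ^ 2, K' ^ 2, by positivity, by positivity, fun p s γ hs hsp hγ => ?_⟩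
  have hnn := SparseDetection.rateSq_nonneg hs hsp hγ
  have hsq := Real.sq_sqrt hnn
  have h3 := h1 p s γ hs hsp hγ
  have h4 := h2 p s γ hs hsp hγ
  constructor
  · rw [div_mul_eq_mul_div, one_mul, div_le_iff₀ (by positivity), ← hsq, ← mul_pow, mul_comm _ K]
    exact pow_le_pow_left₀ (Real.sqrt_nonneg _) h3 2
  · rw [← hsq, ← mul_pow]
    exact pow_le_pow_left₀ (hεs.1 p s γ hs hsp hγ) h4 2
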